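/- Work over $\mathbb{C}$. Let $r\ge 2$, let $a_1\ge\cdots\ge a_r$ be integers, let $\mathcal{E}=\mathcal{O}_{\mathbb{P}^1}(a_1)\oplus\cdots\oplus\mathcal{O}_{\mathbb{P}^1}(a_r)$, and let $\ell\ge -1$ be an integer. For a morphism $\Phi:\mathcal{E}\to\mathcal{E}(2+\ell)$, call a coherent subsheaf $\mathcal{F}\subseteq\mathcal{E}$ *invariant* if $\Phi(\mathcal{F})\subseteq\mathcal{F}(2+\ell)$, and call the pair $(\mathcal{E},\Phi)$ *semistable* (resp. *stable*) if $\mu(\mathcal{F})\le\mu(\mathcal{E})$ (resp. $\mu(\mathcal{F})<\mu(\mathcal{E})$) for every invariant coherent subsheaf $0\subsetneq\mathcal{F}\subsetneq\mathcal{E}$, where $\mu=\deg/\operatorname{rank}$. A *subbundle* of $\mathcal{E}$ is a subsheaf $\mathcal{F}$ with $\mathcal{E}/\mathcal{F}$ locally free; it is *proper* if $0\ne\mathcal{F}\ne\mathcal{E}$. (i) If $(\mathcal{E},\Phi)$ is semistable for some $\Phi:\mathcal{E}\to\mathcal{E}(2+\ell)$, then $a_{i+1}\ge a_i-\ell-2$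 for all $1\le i\le r-1$. (ii) Conversely, suppose that $a_{i+1}\ge a_i-\ell-2$ for all $1\le i\le r-1$. Then there is a $\Phi:\mathcal{E}\to\mathcal{E}(2+\ell)$ for which $\mathcal{E}$ has no invariant proper subbundle, and for every such $\Phi$ the pair $(\mathcal{E},\Phi)$ is stable. The set of all $\Phi$ without invariant proper subbundle is a non-empty Zariski-open subset of the vector space $H^0(\mathcal{E}nd(\mathcal{E})(2+\ell))$. Moreover, it contains the $\Phi$ which, on the affine chart with coordinate $z=z_0/z_1$ and in the trivializations $z_1^{a_i}$ of the summands, is given by $e_1\mapsto e_2\mapsto\cdots\mapsto e_r\mapsto z\,e_1$, and the characteristic polynomial of this matrix is irreducible in $\mathbb{C}[z][t]$. -/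

import Mathlib

open Polynomial LaurentPolynomial

noncomputable section

/-!
Coherent sheaves on the complex projective line, described on its standard affine cover.

The line `ℙ¹` over `ℂ`, with homogeneous coordinates `z₀, z₁`, is covered by the affine lines
`U₀ = {z₁ ≠ 0} = Spec ℂ[z]` with `z = z₀ / z₁`, and `U₁ = {z₀ ≠ 0} = Spec ℂ[w]` with
`w = z₁ / z₀ = z⁻¹`, whose intersection is `U₀₁ = Spec ℂ[z, z⁻¹]`.
Both `ℂ[z]` and `ℂ[w]` are Mathlib's `ℂ[X]`, and `ℂ[z, z⁻¹]` is `ℂ[T;T⁻¹]`, so that the two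
restriction maps of the structure sheaf are `X ↦ T` and `X ↦ T⁻¹`.
A quasi-coherent sheaf is the datum of its modules of sections over `U₀`, `U₁` and `U₀₁` and of
the two restriction maps, which have to be localizations.

The bundle `E = 𝒪(a₁) ⊕ ⋯ ⊕ 𝒪(a_r)` is given by `a : Fin r → ℤ`. Its sections over `U₀`, `U₁`,
`U₀₁` are `ℂ[X]^r`, `ℂ[X]^r`, `ℂ[T;T⁻¹]^r`, through the trivializations `z₁ ^ aᵢ` of `𝒪(aᵢ)` on
`U₀` and on `U₀₁`, and `z₀ ^ aᵢ` on `U₁`.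
-/

namespace P1

/-- Restriction of functions from `U₀` to `U₀₁`: `f(z) ↦ f(z)`. -/
def fun0 : ℂ[X] →+* ℂ[T;T⁻¹] := Polynomial.toLaurent

/-- Restriction of functions from `U₁` to `U₀₁`: `g(w) ↦ g(z⁻¹)`. -/
def fun1 : ℂ[X] →+* ℂ[T;T⁻¹] :=
  (LaurentPolynomial.invert (R := ℂ) : ℂ[T;T⁻¹] →+* ℂ[T;T⁻¹]).comp Polynomial.toLaurent

/-- Restriction of sections of `⨁ᵢ 𝒪(aᵢ)` from `U₀` to `U₀₁`. -/
def res0 {r : ℕ} (v : Fin r → ℂ[X]) : Fin r → ℂ[T;T⁻¹] := fun i => fun0 (v i)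

/-- Restriction of sections of `⨁ᵢ 𝒪(aᵢ)` from `U₁` to `U₀₁`: the section `g(w) z₀ ^ a` of `𝒪(a)`
is `z ^ a g(z⁻¹) z₁ ^ a`. -/
def res1 {r : ℕ} (a : Fin r → ℤ) (v : Fin r → ℂ[X]) : Fin r → ℂ[T;T⁻¹] :=
  fun i => T (a i) * fun1 (v i)

/-- The splitting type of `E(n) = E ⊗ 𝒪(n)`, for `E = ⨁ᵢ 𝒪(aᵢ)`. -/
def twistType {r : ℕ} (a : Fin r → ℤ) (n : ℤ) : Fin r → ℤ := fun i => a i + n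

/-- The complex vector space of morphisms of `𝒪`-modules `⨁ᵢ 𝒪(aᵢ) → ⨁ⱼ 𝒪(bⱼ)`: an `𝒪`-linear map
over each of `U₀`, `U₁` and `U₀₁`, compatible with the restrictions. As global sections of a
sheaf `ℋom` are morphisms, `Hom a (twistType a n)` is `H⁰(ℰnd(E)(n)) = H⁰(ℋom(E, E(n)))`. -/
def Hom {r s : ℕ} (a : Fin r → ℤ) (b : Fin s → ℤ) :
    Submodule ℂ (((Fin r → ℂ[X]) →ₗ[ℂ[X]] (Fin s → ℂ[X])) ×
      ((Fin r → ℂ[X]) →ₗ[ℂ[X]] (Fin s → ℂ[X])) ×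
      ((Fin r → ℂ[T;T⁻¹]) →ₗ[ℂ[T;T⁻¹]] (Fin s → ℂ[T;T⁻¹]))) where
  carrier := {φ | (∀ v, φ.2.2 (res0 v) = res0 (φ.1 v)) ∧
    (∀ v, φ.2.2 (res1 a v) = res1 b (φ.2.1 v))}
  add_mem' := by
    rintro φ ψ ⟨h0, h1⟩ ⟨k0, k1⟩
    refine ⟨fun v => ?_, fun v => ?_⟩
    · ext1 i
      simp [h0, k0, res0]
    · ext1 i
      simp [h1, k1, res1, mul_add]
  zero_mem' := by
    refine ⟨fun v => ?_, fun v => ?_⟩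
    · ext1 i
      simp [res0]
    · ext1 i
      simp [res1]
  smul_mem' := by
    rintro c φ ⟨h0, h1⟩
    refine ⟨fun v => ?_, fun v => ?_⟩
    · ext1 i
      simp [h0, res0, fun0, Polynomial.smul_eq_C_mul, LaurentPolynomial.smul_eq_C_mul]
    · ext1 i
      simp [h1, res1, fun1, Polynomial.smul_eq_C_mul, LaurentPolynomial.smul_eq_C_mul]
      ring

/-- The map that a morphism induces on sections over `U₀`. -/
def Hom.on0 {r s : ℕ} {a : Fin r → ℤ} {b : Fin s → ℤ} (Φ : Hom a b) :
    (Fin r → ℂ[X]) →ₗ[ℂ[X]] (Fin s → ℂ[X]) := Φ.1.1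

/-- The map that a morphism induces on sections over `U₁`. -/
def Hom.on1 {r s : ℕ} {a : Fin r → ℤ} {b : Fin s → ℤ} (Φ : Hom a b) :
    (Fin r → ℂ[X]) →ₗ[ℂ[X]] (Fin s → ℂ[X]) := Φ.1.2.1

/-- A coherent subsheaf of `⨁ᵢ 𝒪(aᵢ)`: submodules of sections over `U₀` and over `U₁` that
generate the same submodule of sections over `U₀₁`. (Finite generation is automatic, as `ℂ[X]` is
Noetherian.) -/
@[ext]
structure Subsheaf {r : ℕ} (a : Fin r → ℤ) where
  /-- sections over `U₀` -/
  sec0 : Submodule ℂ[X] (Fin r → ℂ[X])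
  /-- sections over `U₁` -/
  sec1 : Submodule ℂ[X] (Fin r → ℂ[X])
  glue : Submodule.span ℂ[T;T⁻¹] (res0 '' (sec0 : Set (Fin r → ℂ[X]))) =
    Submodule.span ℂ[T;T⁻¹] (res1 a '' (sec1 : Set (Fin r → ℂ[X])))

lemma res1_eq_smul {r : ℕ} (a : Fin r → ℤ) (n : ℤ) (v : Fin r → ℂ[X]) :
    res1 (twistType a n) v = (T n : ℂ[T;T⁻¹]) • res1 a v := by
  ext1 i
  simp only [res1, twistType, Pi.smul_apply, smul_eq_mul, T_add]
  ring

lemma span_res0_top {r : ℕ} :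
    Submodule.span ℂ[T;T⁻¹] (res0 '' (Set.univ : Set (Fin r → ℂ[X]))) = ⊤ := by
  rw [eq_top_iff, ← (Pi.basisFun ℂ[T;T⁻¹] (Fin r)).span_eq, Submodule.span_le]
  rintro _ ⟨i, rfl⟩
  refine Submodule.subset_span ⟨Pi.single i 1, trivial, ?_⟩
  ext1 j
  by_cases h : j = i
  · subst h; simp [res0]
  · simp [res0, h]

lemma span_res1_top {r : ℕ} (a : Fin r → ℤ) :
    Submodule.span ℂ[T;T⁻¹] (res1 a '' (Set.univ : Set (Fin r → ℂ[X]))) = ⊤ := by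
  rw [eq_top_iff, ← (Pi.basisFun ℂ[T;T⁻¹] (Fin r)).span_eq, Submodule.span_le]
  rintro _ ⟨i, rfl⟩
  have h : (Pi.basisFun ℂ[T;T⁻¹] (Fin r)) i =
      (T (-a i) : ℂ[T;T⁻¹]) • res1 a (Pi.single i 1) := by
    ext1 j
    by_cases h : j = i
    · subst h
      simp only [res1, Pi.basisFun_apply, Pi.single_eq_same, Pi.smul_apply, smul_eq_mul, map_one,
        mul_one]
      rw [← T_add, neg_add_cancel, T_zero]
    · simp [res1, h]
  rw [h]
  exact Submodule.smul_mem _ _ (Submodule.subset_span ⟨_, trivial, rfl⟩)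

namespace Subsheaf

variable {r : ℕ} {a : Fin r → ℤ}

/-- The zero subsheaf. -/
instance : Bot (Subsheaf a) where
  bot := ⟨⊥, ⊥, by
    have h0 : (res0 (0 : Fin r → ℂ[X])) = 0 := by ext1 i; simp [res0]
    have h1 : (res1 a (0 : Fin r → ℂ[X])) = 0 := by ext1 i; simp [res1]
    simp [h0, h1]⟩

/-- The whole bundle, as a subsheaf of itself. -/
instance : Top (Subsheaf a) where
  top := ⟨⊤, ⊤, by
    rw [Submodule.top_coe, span_res0_top, span_res1_top]⟩

/-- The subsheaf `F(n) = F ⊗ 𝒪(n)` of `E(n)`. In the trivializations of `𝒪(n)` on `U₀` and `U₁`,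
its sections are those of `F`. -/
def twist (F : Subsheaf a) (n : ℤ) : Subsheaf (twistType a n) where
  sec0 := F.sec0
  sec1 := F.sec1
  glue := by
    rw [F.glue]
    apply le_antisymm
    · rw [Submodule.span_le]
      rintro _ ⟨v, hv, rfl⟩
      have h : res1 a v = (T (-n) : ℂ[T;T⁻¹]) • res1 (twistType a n) v := by
        rw [res1_eq_smul, smul_smul, ← T_add]; simp
      rw [h]
      exact Submodule.smul_mem _ _ (Submodule.subset_span ⟨v, hv, rfl⟩)
    · rw [Submodule.span_le]
      rintro _ ⟨v, hv, rfl⟩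
      rw [res1_eq_smul]
      exact Submodule.smul_mem _ _ (Submodule.subset_span ⟨v, hv, rfl⟩)

/-- `F` is a subbundle of `E`: the quotient sheaf `E / F` is locally free. -/
def IsSubbundle (F : Subsheaf a) : Prop :=
  Module.Projective ℂ[X] ((Fin r → ℂ[X]) ⧸ F.sec0) ∧
    Module.Projective ℂ[X] ((Fin r → ℂ[X]) ⧸ F.sec1)

/-- `Φ(F) ⊆ F(n)`, for `Φ : E → E(n)`. -/
def IsInvariant {n : ℤ} (Φ : Hom a (twistType a n)) (F : Subsheaf a) : Prop :=
  F.sec0.map (Hom.on0 Φ) ≤ (F.twist n).sec0 ∧ F.sec1.map (Hom.on1 Φ) ≤ (F.twist n).sec1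

/-- The rank of `F`. -/
def rank (F : Subsheaf a) : ℕ := Module.finrank ℂ[X] F.sec0

/-- `d` is the degree of `F`, i.e. the degree of the line bundle `det F`: for bases of `F` over
`U₀` and `U₁`, the determinant of the transition matrix over `U₀₁` is a nonzero constant times
`z ^ d`. -/
def HasDegree (F : Subsheaf a) (d : ℤ) : Prop :=
  ∃ (s : ℕ) (b0 : Module.Basis (Fin s) ℂ[X] F.sec0) (b1 : Module.Basis (Fin s) ℂ[X] F.sec1)
    (P : Matrix (Fin s) (Fin s) ℂ[T;T⁻¹]) (c : ℂ),
    (∀ j, res1 a (b1 j : Fin r → ℂ[X]) = ∑ i, P i j • res0 (b0 i : Fin r → ℂ[X])) ∧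
    c ≠ 0 ∧ P.det = LaurentPolynomial.C c * T d

/-! The degree is well defined. -/

lemma linearIndependent_res0 {s : ℕ} {v : Fin s → Fin r → ℂ[X]}
    (hv : LinearIndependent ℂ[X] v) : LinearIndependent ℂ[T;T⁻¹] (fun i => res0 (v i)) := by
  rw [Fintype.linearIndependent_iff] at hv ⊢
  intro g hg
  choose n f hf using fun i => LaurentPolynomial.exists_T_pow (g i)
  let N : ℕ := ∑ i, n i
  have hN : ∀ i, n i ≤ N := fun i =>
    Finset.single_le_sum (f := n) (fun _ _ => Nat.zero_le _) (Finset.mem_univ i)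
  let F : Fin s → ℂ[X] := fun i => f i * X ^ (N - n i)
  have hF : ∀ i, toLaurent (F i) = g i * T (N : ℤ) := by
    intro i
    simp only [F, map_mul, hf, toLaurent_X_pow, mul_T_assoc]
    congr 2
    have := hN i
    push_cast [this]
    ring
  have h0 : ∑ i, F i • v i = 0 := by
    ext1 k
    apply Polynomial.toLaurent_injective
    have hk := congrFun hg k
    simp only [Finset.sum_apply, Pi.smul_apply, smul_eq_mul, map_sum, map_mul, Pi.zero_apply,
      map_zero, hF] at hk ⊢
    calc ∑ i, g i * T (N : ℤ) * toLaurent (v i k)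
        = T (N : ℤ) * ∑ i, g i * res0 (v i) k := by
          rw [Finset.mul_sum]
          refine Finset.sum_congr rfl fun i _ => ?_
          simp only [res0, fun0]
          ring
      _ = 0 := by rw [hk, mul_zero]
  intro i
  have h1 := hF i
  rw [hv F h0 i, map_zero] at h1
  exact ((isUnit_T (R := ℂ) (N : ℤ)).mul_left_eq_zero).1 h1.symm

lemma linearIndependent_res1 {s : ℕ} {v : Fin s → Fin r → ℂ[X]}
    (hv : LinearIndependent ℂ[X] v) : LinearIndependent ℂ[T;T⁻¹] (fun i => res1 a (v i)) := by
  have h := linearIndependent_res0 hv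
  rw [Fintype.linearIndependent_iff] at h ⊢
  intro g hg i
  have h0 : ∑ i, invert (g i) • res0 (v i) = 0 := by
    ext1 k
    have hk := congrFun hg k
    simp only [Finset.sum_apply, Pi.smul_apply, smul_eq_mul, Pi.zero_apply] at hk ⊢
    have h2 : T (a k) * ∑ i, g i * fun1 (v i k) = 0 := by
      rw [← hk, Finset.mul_sum]
      refine Finset.sum_congr rfl fun i _ => ?_
      simp only [res1]
      ring
    have h3 := ((isUnit_T (R := ℂ) (a k)).mul_right_eq_zero).1 h2
    have h4 := congrArg (invert (R := ℂ)) h3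
    rw [map_sum, map_zero] at h4
    rw [← h4]
    refine Finset.sum_congr rfl fun i _ => ?_
    rw [map_mul]
    congr 1
    exact (involutive_invert (R := ℂ) _).symm
  have h5 := h _ h0 i
  exact (map_eq_zero_iff _ (invert (R := ℂ)).injective).1 h5

lemma res0_sum {s : ℕ} (c : Fin s → ℂ[X]) (v : Fin s → Fin r → ℂ[X]) :
    res0 (∑ i, c i • v i) = ∑ i, fun0 (c i) • res0 (v i) := by
  ext1 k
  simp [res0]

lemma res1_sum {s : ℕ} (c : Fin s → ℂ[X]) (v : Fin s → Fin r → ℂ[X]) :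
    res1 a (∑ i, c i • v i) = ∑ i, fun1 (c i) • res1 a (v i) := by
  ext1 k
  simp only [res1, Finset.sum_apply, Pi.smul_apply, smul_eq_mul, map_sum, map_mul, Finset.mul_sum]
  exact Finset.sum_congr rfl fun i _ => by ring

lemma coe_eq_sum {M : Submodule ℂ[X] (Fin r → ℂ[X])} {s : ℕ} (b : Module.Basis (Fin s) ℂ[X] M)
    (x : M) : (x : Fin r → ℂ[X]) = ∑ i, b.repr x i • (b i : Fin r → ℂ[X]) := by
  have h := congrArg M.subtype (b.sum_repr x)
  rw [map_sum] at h
  exact h.symm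

lemma span_res0_basis {M : Submodule ℂ[X] (Fin r → ℂ[X])} {s : ℕ}
    (b : Module.Basis (Fin s) ℂ[X] M) :
    Submodule.span ℂ[T;T⁻¹] (Set.range fun i => res0 (b i : Fin r → ℂ[X])) =
      Submodule.span ℂ[T;T⁻¹] (res0 '' (M : Set (Fin r → ℂ[X]))) := by
  apply le_antisymm <;> rw [Submodule.span_le]
  · rintro _ ⟨i, rfl⟩
    exact Submodule.subset_span ⟨_, (b i).2, rfl⟩
  · rintro _ ⟨x, hx, rfl⟩
    have h := coe_eq_sum b ⟨x, hx⟩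
    rw [show x = _ from h, res0_sum]
    exact Submodule.sum_mem _ fun i _ =>
      Submodule.smul_mem _ _ (Submodule.subset_span ⟨i, rfl⟩)

lemma span_res1_basis {M : Submodule ℂ[X] (Fin r → ℂ[X])} {s : ℕ}
    (b : Module.Basis (Fin s) ℂ[X] M) :
    Submodule.span ℂ[T;T⁻¹] (Set.range fun i => res1 a (b i : Fin r → ℂ[X])) =
      Submodule.span ℂ[T;T⁻¹] (res1 a '' (M : Set (Fin r → ℂ[X]))) := by
  apply le_antisymm <;> rw [Submodule.span_le]
  · rintro _ ⟨i, rfl⟩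
    exact Submodule.subset_span ⟨_, (b i).2, rfl⟩
  · rintro _ ⟨x, hx, rfl⟩
    have h := coe_eq_sum b ⟨x, hx⟩
    rw [show x = _ from h, res1_sum]
    exact Submodule.sum_mem _ fun i _ =>
      Submodule.smul_mem _ _ (Submodule.subset_span ⟨i, rfl⟩)

lemma linearIndependent_coe {M : Submodule ℂ[X] (Fin r → ℂ[X])} {s : ℕ}
    (b : Module.Basis (Fin s) ℂ[X] M) :
    LinearIndependent ℂ[X] (fun i => (b i : Fin r → ℂ[X])) :=
  b.linearIndependent.map' M.subtype M.ker_subtype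

lemma isUnit_laurent {u : ℂ[T;T⁻¹]} (hu : IsUnit u) :
    ∃ (c : ℂ) (d : ℤ), c ≠ 0 ∧ u = LaurentPolynomial.C c * T d := by
  obtain ⟨v, hv⟩ := hu.exists_right_inv
  obtain ⟨n, f, hf⟩ := LaurentPolynomial.exists_T_pow u
  obtain ⟨m, g, hg⟩ := LaurentPolynomial.exists_T_pow v
  have hfg : f * g = X ^ (n + m) := by
    apply Polynomial.toLaurent_injective
    rw [map_mul, hf, hg, toLaurent_X_pow]
    calc u * T (n : ℤ) * (v * T (m : ℤ)) = (u * v) * (T (n : ℤ) * T (m : ℤ)) := by ring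
      _ = T ((n + m : ℕ) : ℤ) := by rw [hv, one_mul, ← T_add]; push_cast; rfl
  obtain ⟨k, -, hk⟩ := (dvd_prime_pow (Polynomial.prime_X (R := ℂ)) _).1 (Dvd.intro _ hfg)
  obtain ⟨w, hw⟩ := hk.symm
  obtain ⟨c, hc, hcw⟩ := Polynomial.isUnit_iff.1 w.isUnit
  refine ⟨c, (k : ℤ) - n, hc.ne_zero, ?_⟩
  have h1 : u * T (n : ℤ) = LaurentPolynomial.C c * T (k : ℤ) := by
    rw [← hf, ← hw, ← hcw, map_mul, toLaurent_X_pow, toLaurent_C, mul_comm]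
  calc u = u * T (n : ℤ) * T (-(n : ℤ)) := by rw [mul_T_assoc]; simp
    _ = _ := by rw [h1, mul_T_assoc, sub_eq_add_neg]

lemma exists_hasDegree (F : Subsheaf a) : ∃ d, F.HasDegree d := by
  obtain ⟨s, b0⟩ := Submodule.basisOfPid (Pi.basisFun ℂ[X] (Fin r)) F.sec0
  obtain ⟨t, b1⟩ := Submodule.basisOfPid (Pi.basisFun ℂ[X] (Fin r)) F.sec1
  have l0 := linearIndependent_res0 (linearIndependent_coe b0)
  have l1 := linearIndependent_res1 (a := a) (linearIndependent_coe b1)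
  have hspan : Submodule.span ℂ[T;T⁻¹] (Set.range fun i => res1 a (b1 i : Fin r → ℂ[X])) =
      Submodule.span ℂ[T;T⁻¹] (Set.range fun i => res0 (b0 i : Fin r → ℂ[X])) := by
    rw [span_res0_basis, span_res1_basis, F.glue]
  let c0 := Module.Basis.span l0
  let c1 := (Module.Basis.span l1).map (LinearEquiv.ofEq _ _ hspan)
  have hst : s = t := by simpa using Fintype.card_congr (c0.indexEquiv c1)
  subst hst
  have hu : IsUnit (c0.toMatrix c1).det := by
    rw [← Module.Basis.det_apply]
    exact c0.isUnit_det c1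
  obtain ⟨c, d, hc, hd⟩ := isUnit_laurent hu
  refine ⟨d, s, b0, b1, c0.toMatrix c1, c, fun j => ?_, hc, hd⟩
  have h := congrArg (Submodule.subtype _) (c0.sum_toMatrix_smul_self (v := c1) j)
  rw [map_sum] at h
  have h1 : (c1 j : Fin r → ℂ[T;T⁻¹]) = res1 a (b1 j : Fin r → ℂ[X]) := by
    simp [c1, Module.Basis.span_apply]
  have h0 : ∀ i, (c0 i : Fin r → ℂ[T;T⁻¹]) = res0 (b0 i : Fin r → ℂ[X]) := fun i => by
    simp [c0, Module.Basis.span_apply]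
  rw [← h1]
  refine h.symm.trans (Finset.sum_congr rfl fun i _ => ?_)
  rw [map_smul, Submodule.subtype_apply, h0]

lemma exists_det_fun {s : ℕ} {M : Submodule ℂ[X] (Fin r → ℂ[X])}
    (b b' : Module.Basis (Fin s) ℂ[X] M) :
    ∃ c : ℂ, c ≠ 0 ∧ (b.toMatrix b').det = Polynomial.C c := by
  have hu : IsUnit (b.toMatrix b').det := by
    rw [← Module.Basis.det_apply]
    exact b.isUnit_det b'
  obtain ⟨c, hc, h⟩ := Polynomial.isUnit_iff.1 hu
  exact ⟨c, hc.ne_zero, h.symm⟩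

lemma HasDegree.unique {F : Subsheaf a} {d d' : ℤ} (h : F.HasDegree d) (h' : F.HasDegree d') :
    d = d' := by
  obtain ⟨s, b0, b1, P, c, hP, hc, hd⟩ := h
  obtain ⟨s', b0', b1', P', c', hP', hc', hd'⟩ := h'
  have hs : s = s' := by simpa using Fintype.card_congr (b0.indexEquiv b0')
  subst hs
  obtain ⟨u0, hu0, e0⟩ := exists_det_fun b0 b0'
  obtain ⟨u1, hu1, e1⟩ := exists_det_fun b1 b1'
  have key : (b0.toMatrix b0').map fun0 * P' = P * (b1.toMatrix b1').map fun1 := by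
    have l0 := linearIndependent_res0 (linearIndependent_coe b0)
    ext1 k j
    have hA : res1 a (b1' j : Fin r → ℂ[X]) =
        ∑ k, ((b0.toMatrix b0').map fun0 * P') k j • res0 (b0 k : Fin r → ℂ[X]) := by
      rw [hP' j]
      simp_rw [Matrix.mul_apply, Finset.sum_smul]
      rw [Finset.sum_comm]
      refine Finset.sum_congr rfl fun i _ => ?_
      rw [coe_eq_sum b0 (b0' i), res0_sum, Finset.smul_sum]
      refine Finset.sum_congr rfl fun k _ => ?_
      rw [smul_smul, mul_comm]
      rfl
    have hB : res1 a (b1' j : Fin r → ℂ[X]) =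
        ∑ k, (P * (b1.toMatrix b1').map fun1) k j • res0 (b0 k : Fin r → ℂ[X]) := by
      rw [coe_eq_sum b1 (b1' j), res1_sum]
      simp_rw [Matrix.mul_apply, Finset.sum_smul]
      rw [Finset.sum_comm]
      refine Finset.sum_congr rfl fun i _ => ?_
      rw [hP i, Finset.smul_sum]
      refine Finset.sum_congr rfl fun k _ => ?_
      rw [smul_smul, mul_comm]
      rfl
    have hAB := hA.symm.trans hB
    rw [← sub_eq_zero, ← Finset.sum_sub_distrib] at hAB
    simp_rw [← sub_smul] at hAB
    exact sub_eq_zero.1 (Fintype.linearIndependent_iff.1 l0 _ hAB k)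
  have hdet := congrArg Matrix.det key
  rw [Matrix.det_mul, Matrix.det_mul] at hdet
  have f0 : ((b0.toMatrix b0').map fun0).det = LaurentPolynomial.C u0 := by
    rw [← RingHom.mapMatrix_apply, ← RingHom.map_det, e0]
    simp [fun0]
  have f1 : ((b1.toMatrix b1').map fun1).det = LaurentPolynomial.C u1 := by
    rw [← RingHom.mapMatrix_apply, ← RingHom.map_det, e1]
    simp [fun1]
  rw [f0, f1, hd, hd'] at hdet
  have h2 : LaurentPolynomial.C (u0 * c') * T d' = LaurentPolynomial.C (u1 * c) * T d := by
    rw [map_mul, map_mul, mul_assoc, hdet]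
    ring
  have h3 := congrArg LaurentPolynomial.degree h2
  rw [degree_C_mul_T _ _ (mul_ne_zero hu0 hc'), degree_C_mul_T _ _ (mul_ne_zero hu1 hc)] at h3
  exact (WithBot.coe_injective h3).symm

/-- The degree of `F`. -/
def degree (F : Subsheaf a) : ℤ := F.exists_hasDegree.choose

lemma hasDegree_degree (F : Subsheaf a) : F.HasDegree F.degree := F.exists_hasDegree.choose_spec

/-- The slope `μ(F) = deg F / rank F` (of a nonzero subsheaf). -/
def slope (F : Subsheaf a) : ℚ := (F.degree : ℚ) / (F.rank : ℚ)

end Subsheaf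

/-- The pair `(E, Φ)`, where `E = ⨁ᵢ 𝒪(aᵢ)` and `Φ : E → E(n)`, is semistable. -/
def IsSemistable {r : ℕ} {a : Fin r → ℤ} {n : ℤ} (Φ : Hom a (twistType a n)) : Prop :=
  ∀ F : Subsheaf a, F ≠ ⊥ → F ≠ ⊤ → F.IsInvariant Φ → F.slope ≤ (⊤ : Subsheaf a).slope

/-- The pair `(E, Φ)`, where `E = ⨁ᵢ 𝒪(aᵢ)` and `Φ : E → E(n)`, is stable. -/
def IsStable {r : ℕ} {a : Fin r → ℤ} {n : ℤ} (Φ : Hom a (twistType a n)) : Prop :=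
  ∀ F : Subsheaf a, F ≠ ⊥ → F ≠ ⊤ → F.IsInvariant Φ → F.slope < (⊤ : Subsheaf a).slope

/-- No proper nonzero subbundle `F` of `E` satisfies `Φ(F) ⊆ F(n)`. -/
def HasNoInvariantSubbundle {r : ℕ} {a : Fin r → ℤ} {n : ℤ} (Φ : Hom a (twistType a n)) : Prop :=
  ∀ F : Subsheaf a, F.IsSubbundle → F ≠ ⊥ → F ≠ ⊤ → ¬ F.IsInvariant Φ

/-- The companion-type matrix of the map `e₁ ↦ e₂ ↦ ⋯ ↦ e_r ↦ z e₁` (columns are the images of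
the basis vectors). -/
def companion (r : ℕ) : Matrix (Fin r) (Fin r) ℂ[X] :=
  Matrix.of fun i j =>
    if (i : ℕ) = j + 1 then 1 else if (i : ℕ) = 0 ∧ (j : ℕ) + 1 = r then X else 0

/-- Polynomial functions on a complex vector space: the algebra of functions generated by the
linear forms. -/
def polyFun (V : Type*) [AddCommGroup V] [Module ℂ V] : Subalgebra ℂ (V → ℂ) :=
  Algebra.adjoin ℂ (Set.range fun l : Module.Dual ℂ V => (l : V → ℂ))

/-- Zariski open subsets of a (finite-dimensional) complex vector space: complements of the set of
common zeros of a family of polynomial functions. -/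
def IsZariskiOpen {V : Type*} [AddCommGroup V] [Module ℂ V] (U : Set V) : Prop :=
  ∃ S : Set (V → ℂ), S ⊆ (polyFun V : Set (V → ℂ)) ∧ Uᶜ = {v | ∀ f ∈ S, f v = 0}

end P1

end

namespace P1

/-! A subbundle is determined by its sections over `U₀`, and every saturated submodule of `ℂ[X]^r`
arises this way. So `Φ` has no invariant proper subbundle iff every nonzero submodule invariant
under its matrix over `U₀` has full rank (`hasNoInvariantSubbundle_iff`), and over a principal ideal
domain this means that the characteristic polynomial is irreducible (`irreducible_charpoly_iff`).

Stability: for such `Φ` a nonzero invariant `F` has rank `r`, and the determinant of `F ⊆ E` is a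
nonzero section of a line bundle of degree `deg E - deg F`; this degree is positive unless `F = E`
(`Subsheaf.degree_lt_of_rank_eq`).

Existence: the companion matrix extends over `U₁` by the gap condition, and its characteristic
polynomial `t ^ r - z` is Eisenstein at `z`.

Openness: factors of the characteristic polynomial have coefficients integral over the coordinates
of `Φ`, so by lying over, a factorization persists on the Zariski closure (`mem_factorLocus`).

Necessity of the gap condition: where a gap is too large, all maps from the earlier summands to the
twisted later ones vanish, and the earlier summands form an invariant subbundle of too large slope
(`IsSemistable.gap_le`). -/

/-! ### Restriction to `U₀₁` and clearing of denominators -/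

lemma fun0_injective : Function.Injective fun0 := Polynomial.toLaurent_injective

lemma fun1_injective : Function.Injective fun1 :=
  (invert (R := ℂ)).injective.comp Polynomial.toLaurent_injective

lemma fun0_X_pow (n : ℕ) : fun0 (X ^ n) = T n := toLaurent_X_pow n

lemma fun1_X_pow (n : ℕ) : fun1 (X ^ n) = T (-n) := by simp [fun1]

lemma res0_injective {r : ℕ} : Function.Injective (res0 (r := r)) := fun _ _ h =>
  funext fun i => fun0_injective (congrFun h i)

lemma res0_smul {r : ℕ} (f : ℂ[X]) (v : Fin r → ℂ[X]) : res0 (f • v) = fun0 f • res0 v := by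
  ext1 i; simp [res0]

lemma res0_add {r : ℕ} (v w : Fin r → ℂ[X]) : res0 (v + w) = res0 v + res0 w := by
  ext1 i; simp [res0]

lemma res0_zero {r : ℕ} : res0 (0 : Fin r → ℂ[X]) = 0 := by
  ext1 i; simp [res0]

lemma res1_smul {r : ℕ} (a : Fin r → ℤ) (f : ℂ[X]) (v : Fin r → ℂ[X]) :
    res1 a (f • v) = fun1 f • res1 a v := by
  ext1 i; simp only [res1, Pi.smul_apply, smul_eq_mul, map_mul]; ring

lemma res1_add {r : ℕ} (a : Fin r → ℤ) (v w : Fin r → ℂ[X]) :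
    res1 a (v + w) = res1 a v + res1 a w := by
  ext1 i; simp [res1, mul_add]

lemma res1_zero {r : ℕ} (a : Fin r → ℤ) : res1 a (0 : Fin r → ℂ[X]) = 0 := by
  ext1 i; simp [res1]

/-- Every section over `U₀₁` extends to `U₀` after multiplication by a power of `z`. -/
lemma exists_T_smul_eq_res0 {r : ℕ} (x : Fin r → ℂ[T;T⁻¹]) :
    ∃ (n : ℕ) (v : Fin r → ℂ[X]), (T n : ℂ[T;T⁻¹]) • x = res0 v := by
  choose n f hf using fun i => LaurentPolynomial.exists_T_pow (x i)
  refine ⟨∑ i, n i, fun i => X ^ ((∑ i, n i) - n i) * f i, ?_⟩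
  ext1 i
  have hi : n i ≤ ∑ i, n i :=
    Finset.single_le_sum (f := n) (fun _ _ => Nat.zero_le _) (Finset.mem_univ i)
  simp only [res0, fun0, Pi.smul_apply, smul_eq_mul, map_mul, hf, toLaurent_X_pow]
  rw [mul_comm (x i), ← mul_assoc, ← T_add]
  congr 2
  rw [Nat.cast_sub hi]; ring

/-- Every section over `U₀₁` extends to `U₁` after multiplication by a power of `z⁻¹`. -/
lemma exists_T_neg_smul_eq_res1 {r : ℕ} (a : Fin r → ℤ) (x : Fin r → ℂ[T;T⁻¹]) :
    ∃ (n : ℕ) (v : Fin r → ℂ[X]), (T (-n) : ℂ[T;T⁻¹]) • x = res1 a v := by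
  -- Once the twist `T (a i)` is removed, `z ↦ z⁻¹` reduces the claim to the one over `U₀`.
  obtain ⟨n, v, h⟩ := exists_T_smul_eq_res0 fun i => invert (T (-a i) * x i)
  refine ⟨n, v, ?_⟩
  ext1 i
  have hi := congrArg (invert (R := ℂ)) (congrFun h i)
  simp only [Pi.smul_apply, smul_eq_mul, map_mul, invert_T, res0, fun0, neg_neg] at hi
  have h2 : ∀ y : ℂ[T;T⁻¹], invert (invert y) = y := involutive_invert (R := ℂ)
  simp only [h2, res1, fun1, RingHom.comp_apply] at hi ⊢
  have h3 : T (a i) * T (-a i) = (1 : ℂ[T;T⁻¹]) := by rw [← T_add]; simp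
  change T (-n : ℤ) * x i = T (a i) * invert (toLaurent (v i))
  rw [← hi]
  linear_combination (-(T (-n : ℤ) * x i)) * h3

/-- The sections over `U₀₁` generated by a module of sections over `U₀`. -/
lemma mem_span_res0 {r : ℕ} {N : Submodule ℂ[X] (Fin r → ℂ[X])} {x : Fin r → ℂ[T;T⁻¹]} :
    x ∈ Submodule.span ℂ[T;T⁻¹] (res0 '' (N : Set (Fin r → ℂ[X]))) ↔
      ∃ (n : ℕ), ∃ u ∈ N, (T n : ℂ[T;T⁻¹]) • x = res0 u := by
  constructor
  · intro hx
    induction hx using Submodule.span_induction with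
    | mem x h =>
      obtain ⟨u, hu, rfl⟩ := h
      exact ⟨0, u, hu, by simp⟩
    | zero => exact ⟨0, 0, N.zero_mem, by simp [res0_zero]⟩
    | add x y _ _ hx hy =>
      obtain ⟨n, u, hu, h⟩ := hx
      obtain ⟨m, v, hv, k⟩ := hy
      refine ⟨n + m, X ^ m • u + X ^ n • v, N.add_mem (N.smul_mem _ hu) (N.smul_mem _ hv), ?_⟩
      rw [res0_add, res0_smul, res0_smul, ← h, ← k, fun0_X_pow, fun0_X_pow, smul_smul, smul_smul,
        ← T_add, ← T_add, smul_add]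
      push_cast
      rw [add_comm (m : ℤ)]
    | smul c x _ hx =>
      obtain ⟨n, u, hu, h⟩ := hx
      obtain ⟨m, g, hg⟩ := LaurentPolynomial.exists_T_pow c
      refine ⟨n + m, g • u, N.smul_mem _ hu, ?_⟩
      rw [res0_smul, ← h, smul_smul, smul_smul, fun0, hg]
      push_cast
      rw [T_add]
      congr 1
      ring
  · rintro ⟨n, u, hu, h⟩
    have : x = (T (-n) : ℂ[T;T⁻¹]) • res0 u := by
      rw [← h, smul_smul, ← T_add]; simp
    rw [this]
    exact Submodule.smul_mem _ _ (Submodule.subset_span ⟨u, hu, rfl⟩)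

/-- The elements of a module having a nonzero multiple in the submodule `N`. -/
def saturation {R M : Type*} [CommRing R] [AddCommGroup M] [Module R M] (N : Submodule R M) :
    Submodule R M := (Submodule.torsion R (M ⧸ N)).comap N.mkQ

/-! ### Saturated submodules and ranks -/

section saturation

variable {R M : Type*} [CommRing R] [IsDomain R] [AddCommGroup M] [Module R M]

lemma mem_saturation {N : Submodule R M} {v : M} :
    v ∈ saturation N ↔ ∃ f : R, f ≠ 0 ∧ f • v ∈ N := by
  rw [saturation, Submodule.mem_comap, Submodule.mem_torsion_iff]
  constructor
  · rintro ⟨f, hf⟩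
    exact ⟨f, nonZeroDivisors.coe_ne_zero f, (Submodule.Quotient.mk_eq_zero N).1 hf⟩
  · rintro ⟨f, hf, h⟩
    exact ⟨⟨f, mem_nonZeroDivisors_of_ne_zero hf⟩, (Submodule.Quotient.mk_eq_zero N).2 h⟩

lemma le_saturation (N : Submodule R M) : N ≤ saturation N := fun v hv =>
  mem_saturation.2 ⟨1, one_ne_zero, by simpa⟩

lemma mem_saturation_of_smul_mem {N : Submodule R M} {f : R} (hf : f ≠ 0) {v : M}
    (h : f • v ∈ saturation N) : v ∈ saturation N := by
  obtain ⟨g, hg, h⟩ := mem_saturation.1 h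
  exact mem_saturation.2 ⟨g * f, mul_ne_zero hg hf, by rwa [mul_smul]⟩

lemma map_saturation_le {N : Submodule R M} {φ : M →ₗ[R] M} (h : N.map φ ≤ N) :
    (saturation N).map φ ≤ saturation N := by
  rintro _ ⟨v, hv, rfl⟩
  obtain ⟨f, hf, hv⟩ := mem_saturation.1 hv
  exact mem_saturation.2 ⟨f, hf, by rw [← map_smul]; exact h ⟨_, hv, rfl⟩⟩

/-- The quotient is finitely generated and torsion-free, hence free over a principal ideal domain.
-/
lemma projective_quotient [IsPrincipalIdealRing R] [Module.Finite R M] {N : Submodule R M}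
    (h : ∀ (f : R) (v : M), f ≠ 0 → f • v ∈ N → v ∈ N) : Module.Projective R (M ⧸ N) := by
  have : Module.IsTorsionFree R (M ⧸ N) := by
    rw [Submodule.isTorsionFree_iff_torsion_eq_bot, eq_bot_iff]
    intro x hx
    obtain ⟨v, rfl⟩ := N.mkQ_surjective x
    obtain ⟨f, hf, hv⟩ := mem_saturation.1 (show v ∈ saturation N from hx)
    exact (Submodule.Quotient.mk_eq_zero N).2 (h f v hf hv)
  infer_instance

lemma finrank_eq_of_saturation_eq_top [Module.Finite R M] {N : Submodule R M}
    (h : saturation N = ⊤) : Module.finrank R N = Module.finrank R M := by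
  have h1 := Submodule.finrank_quotient_add_finrank N
  have h2 : Module.finrank R (M ⧸ N) = 0 := by
    rw [Module.finrank_eq_zero_iff_isTorsion]
    intro x
    obtain ⟨v, rfl⟩ := N.mkQ_surjective x
    have hv : v ∈ saturation N := h ▸ trivial
    exact (Submodule.mem_torsion_iff _).1 hv
  omega

/-- The quotient has rank zero, so it is torsion; being projective it is torsion-free, so it
vanishes. -/
lemma eq_top_of_finrank_eq [Module.Finite R M] {N : Submodule R M}
    [Module.Projective R (M ⧸ N)] (h : Module.finrank R N = Module.finrank R M) : N = ⊤ := by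
  have h1 := Submodule.finrank_quotient_add_finrank N
  have h2 : Module.finrank R (M ⧸ N) = 0 := by omega
  rw [Module.finrank_eq_zero_iff] at h2
  rw [eq_top_iff]
  intro v _
  obtain ⟨f, hf, h⟩ := h2 (N.mkQ v)
  rw [smul_eq_zero] at h
  exact (Submodule.Quotient.mk_eq_zero N).1 (h.resolve_left hf)

end saturation

/-! ### From invariant subbundles to invariant submodules over `U₀` -/

section

variable {r : ℕ}

lemma Hom.res0_on0 {s : ℕ} {a : Fin r → ℤ} {b : Fin s → ℤ} (Φ : Hom a b) (v : Fin r → ℂ[X]) :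
    res0 (Hom.on0 Φ v) = Φ.1.2.2 (res0 v) := (Φ.2.1 v).symm

lemma Hom.res1_on1 {s : ℕ} {a : Fin r → ℤ} {b : Fin s → ℤ} (Φ : Hom a b) (v : Fin r → ℂ[X]) :
    res1 b (Hom.on1 Φ v) = Φ.1.2.2 (res1 a v) := (Φ.2.2 v).symm

namespace Subsheaf

variable {a : Fin r → ℤ}

/-- The largest subsheaf with prescribed sections over `U₀`. -/
def ofSec0 (a : Fin r → ℤ) (N : Submodule ℂ[X] (Fin r → ℂ[X])) : Subsheaf a where
  sec0 := N
  sec1 :=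
    { carrier := {v | res1 a v ∈ Submodule.span ℂ[T;T⁻¹] (res0 '' (N : Set (Fin r → ℂ[X])))}
      add_mem' := fun {v w} hv hw => by
        rw [Set.mem_ofPred_eq] at *
        rw [res1_add]
        exact add_mem hv hw
      zero_mem' := by
        rw [Set.mem_ofPred_eq, res1_zero]
        exact zero_mem _
      smul_mem' := fun f v hv => by
        rw [Set.mem_ofPred_eq, res1_smul]
        exact Submodule.smul_mem _ _ hv }
  glue := by
    apply le_antisymm <;> rw [Submodule.span_le]
    · rintro _ ⟨u, hu, rfl⟩
      obtain ⟨n, v, h⟩ := exists_T_neg_smul_eq_res1 a (res0 u)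
      have h' : res0 u = (T n : ℂ[T;T⁻¹]) • res1 a v := by
        rw [← h, smul_smul, ← T_add]; simp
      rw [h']
      refine Submodule.smul_mem _ _ (Submodule.subset_span ⟨v, ?_, rfl⟩)
      rw [SetLike.mem_coe, Submodule.mem_mk]
      change res1 a v ∈ Submodule.span _ _
      rw [← h]
      exact Submodule.smul_mem _ _ (Submodule.subset_span ⟨u, hu, rfl⟩)
    · rintro _ ⟨v, hv, rfl⟩
      exact hv

lemma mem_ofSec0_sec1 {N : Submodule ℂ[X] (Fin r → ℂ[X])} {v : Fin r → ℂ[X]} :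
    v ∈ (ofSec0 a N).sec1 ↔
      res1 a v ∈ Submodule.span ℂ[T;T⁻¹] (res0 '' (N : Set (Fin r → ℂ[X]))) := Iff.rfl

/-- Saturatedness survives inverting `z`, since powers of `z` can be cleared from `h` and `x`. This
is what makes the extension to `U₁` saturated too. -/
lemma mem_span_res0_saturation {N : Submodule ℂ[X] (Fin r → ℂ[X])} {h : ℂ[T;T⁻¹]} (h0 : h ≠ 0)
    {x : Fin r → ℂ[T;T⁻¹]}
    (hx : h • x ∈ Submodule.span ℂ[T;T⁻¹] (res0 '' (saturation N : Set (Fin r → ℂ[X])))) :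
    x ∈ Submodule.span ℂ[T;T⁻¹] (res0 '' (saturation N : Set (Fin r → ℂ[X]))) := by
  obtain ⟨k, w, hw⟩ := exists_T_smul_eq_res0 x
  obtain ⟨m, g, hg⟩ := LaurentPolynomial.exists_T_pow h
  obtain ⟨n, u, hu, h⟩ := mem_span_res0.1 hx
  have hg0 : g ≠ 0 := by
    rintro rfl
    rw [map_zero] at hg
    exact h0 (((isUnit_T (R := ℂ) (m : ℤ)).mul_left_eq_zero).1 hg.symm)
  have key : (X ^ n * g) • w = (X ^ (m + k) : ℂ[X]) • u := by
    apply res0_injective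
    rw [res0_smul, res0_smul, ← hw, ← h, map_mul, fun0_X_pow, fun0_X_pow, fun0, hg]
    push_cast
    simp only [smul_smul, T_add]
    congr 1
    ring
  refine mem_span_res0.2 ⟨k, w, ?_, hw⟩
  refine mem_saturation_of_smul_mem (f := X ^ n * g)
    (mul_ne_zero (pow_ne_zero _ Polynomial.X_ne_zero) hg0) ?_
  rw [key]
  exact Submodule.smul_mem _ _ hu

lemma isSubbundle_ofSec0 (N : Submodule ℂ[X] (Fin r → ℂ[X])) :
    (ofSec0 a (saturation N)).IsSubbundle := by
  refine ⟨projective_quotient fun f v hf h => mem_saturation_of_smul_mem hf h,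
    projective_quotient fun f v hf h => ?_⟩
  rw [mem_ofSec0_sec1] at h ⊢
  rw [res1_smul] at h
  exact mem_span_res0_saturation ((map_ne_zero_iff _ fun1_injective).2 hf) h

lemma isInvariant_ofSec0 {n : ℤ} {Φ : Hom a (twistType a n)}
    {N : Submodule ℂ[X] (Fin r → ℂ[X])} (h : N.map (Hom.on0 Φ) ≤ N) :
    (ofSec0 a N).IsInvariant Φ := by
  refine ⟨h, ?_⟩
  rintro _ ⟨v, hv, rfl⟩
  change Hom.on1 Φ v ∈ (ofSec0 a N).sec1
  change v ∈ (ofSec0 a N).sec1 at hv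
  rw [mem_ofSec0_sec1, mem_span_res0] at hv
  obtain ⟨m, u, hu, hv⟩ := hv
  rw [mem_ofSec0_sec1]
  -- The exponent `-m` undoes the clearing of denominators of `v`, and `-n` undoes the twist of the
  -- target.
  have h1 : res1 a (Hom.on1 Φ v) = (T (-n - m) : ℂ[T;T⁻¹]) • res0 (Hom.on0 Φ u) := by
    rw [Hom.res0_on0, ← hv, map_smul, ← Hom.res1_on1, res1_eq_smul, smul_smul, smul_smul,
      ← T_add, ← T_add]
    simp
  rw [h1]
  exact Submodule.smul_mem _ _ (Submodule.subset_span ⟨_, h ⟨u, hu, rfl⟩, rfl⟩)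

lemma finrank_sec1 (F : Subsheaf a) :
    Module.finrank ℂ[X] F.sec1 = Module.finrank ℂ[X] F.sec0 := by
  obtain ⟨s, b0, b1, -⟩ := F.hasDegree_degree
  rw [Module.finrank_eq_card_basis b0, Module.finrank_eq_card_basis b1]

lemma eq_bot_of_sec0_eq_bot {F : Subsheaf a} (h : F.sec0 = ⊥) : F = ⊥ := by
  have h1 : F.sec1 = ⊥ := by
    rw [← Submodule.finrank_eq_zero (R := ℂ[X]), finrank_sec1, h, finrank_bot]
  exact Subsheaf.ext h h1

end Subsheaf

/-- Invariant subbundles are detected by their modules of sections over `U₀`. -/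
lemma hasNoInvariantSubbundle_iff {a : Fin r → ℤ} {n : ℤ} (Φ : Hom a (twistType a n)) :
    HasNoInvariantSubbundle Φ ↔ ∀ N : Submodule ℂ[X] (Fin r → ℂ[X]),
      N.map (Hom.on0 Φ) ≤ N → N ≠ ⊥ → Module.finrank ℂ[X] N = r := by
  constructor
  · intro h N hN h0
    -- Saturating changes neither invariance nor rank and yields a subbundle, which must be
    -- everything.
    have h1 : Subsheaf.ofSec0 a (saturation N) = ⊤ := by
      by_contra htop
      refine h _ (Subsheaf.isSubbundle_ofSec0 N) (fun hbot => h0 ?_) htop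
        (Subsheaf.isInvariant_ofSec0 (map_saturation_le hN))
      have : saturation N = ⊥ := congrArg Subsheaf.sec0 hbot
      exact eq_bot_iff.2 (this ▸ le_saturation N)
    have h2 : saturation N = ⊤ := congrArg Subsheaf.sec0 h1
    simpa using finrank_eq_of_saturation_eq_top h2
  · intro h F hF hbot htop hinv
    have h0 := h F.sec0 hinv.1 fun h => hbot (Subsheaf.eq_bot_of_sec0_eq_bot h)
    have := hF.1
    have := hF.2
    exact htop (Subsheaf.ext (eq_top_of_finrank_eq (by simpa using h0))
      (eq_top_of_finrank_eq (by simpa [Subsheaf.finrank_sec1] using h0)))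

end

/-! ### Irreducible characteristic polynomials and invariant submodules -/

section charpoly

variable {R M : Type*} [CommRing R] [AddCommGroup M] [Module R M]

lemma aeval_restrict_apply {N : Submodule R M} {φ : Module.End R M} (hN : ∀ x ∈ N, φ x ∈ N)
    (p : R[X]) (v : N) : ((aeval (φ.restrict hN) p v : N) : M) = aeval φ p (v : M) := by
  induction p using Polynomial.induction_on' generalizing v with
  | add p q hp hq => simp [hp, hq]
  | monomial n c =>
    simp only [aeval_monomial, Module.End.mul_apply, Module.algebraMap_end_apply,
      Submodule.coe_smul]
    congr 1
    rw [Module.End.pow_restrict]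
    rfl

variable [IsDomain R]

lemma exists_map_eq_C_mul (u : (FractionRing R)[X]) :
    ∃ (b : R) (u' : R[X]), b ≠ 0 ∧
      u'.map (algebraMap R (FractionRing R)) = Polynomial.C (algebraMap R _ b) * u := by
  obtain ⟨b, hb0, hb⟩ := IsLocalization.integerNormalization_spec (nonZeroDivisors R) u
  refine ⟨b, _, nonZeroDivisors.ne_zero hb0, hb.trans ?_⟩
  rw [Algebra.smul_def]
  rfl

/-- By Gauss's lemma `q` stays irreducible over the fraction field. There it cannot divide `p`,
which has smaller degree, so the two are coprime; `b` clears the denominators of a Bézout relation.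
-/
lemma exists_bezout_of_irreducible [IsIntegrallyClosed R] {p q : R[X]} (hq : Irreducible q)
    (hqm : q.Monic) (hp : p ≠ 0) (hpq : p.natDegree < q.natDegree) :
    ∃ (b : R) (u w : R[X]), b ≠ 0 ∧ u * q + w * p = Polynomial.C b := by
  have hinj : Function.Injective (algebraMap R (FractionRing R)) := IsFractionRing.injective R _
  have hq' := (hqm.irreducible_iff_irreducible_map_fraction_map (K := FractionRing R)).1 hq
  have hcop : IsCoprime (q.map (algebraMap R (FractionRing R)))
      (p.map (algebraMap R (FractionRing R))) := by
    refine hq'.coprime_iff_not_dvd.2 fun h => ?_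
    refine Polynomial.not_dvd_of_natDegree_lt ((Polynomial.map_ne_zero_iff hinj).2 hp) ?_ h
    rwa [natDegree_map_eq_of_injective hinj, natDegree_map_eq_of_injective hinj]
  obtain ⟨u, w, h⟩ := hcop
  obtain ⟨b, u', hb, hu⟩ := exists_map_eq_C_mul u
  obtain ⟨c, w', hc, hw⟩ := exists_map_eq_C_mul w
  refine ⟨b * c, Polynomial.C c * u', Polynomial.C b * w', mul_ne_zero hb hc, ?_⟩
  apply Polynomial.map_injective _ hinj
  simp only [Polynomial.map_add, Polynomial.map_mul, Polynomial.map_C, hu, hw, map_mul]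
  linear_combination (Polynomial.C (algebraMap R (FractionRing R) b) *
    Polynomial.C (algebraMap R (FractionRing R) c)) * h

/-- The submodule is the cyclic one generated by `w`. As `h` is monic, division by it shows that
polynomials of degree less than `h.natDegree` already produce all of it. -/
lemma exists_invariant_of_aeval_eq_zero (φ : Module.End R M) {h : R[X]} (hm : h.Monic)
    (hd : h.natDegree ≠ 0) {w : M} (hw : w ≠ 0) (hh : aeval φ h w = 0) :
    ∃ N : Submodule R M, N.map φ ≤ N ∧ N ≠ ⊥ ∧ Module.finrank R N ≤ h.natDegree := by
  let e : R[X] →ₗ[R] M := (LinearMap.applyₗ w).comp (aeval φ).toLinearMap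
  have he : ∀ q, e q = aeval φ q w := fun q => rfl
  have hmod : ∀ q, e (q %ₘ h) = e q := by
    intro q
    conv_rhs => rw [← modByMonic_add_div q h]
    rw [he, he, map_add, mul_comm, map_mul, LinearMap.add_apply, Module.End.mul_apply, hh, map_zero,
      add_zero]
  have hfin : Module.finrank R (degreeLT R h.natDegree) = h.natDegree := by
    rw [(degreeLTEquiv R h.natDegree).finrank_eq, Module.finrank_fin_fun]
  have : Module.Finite R (degreeLT R h.natDegree) :=
    Module.Finite.equiv (degreeLTEquiv R h.natDegree).symm
  refine ⟨(degreeLT R h.natDegree).map e, ?_, ?_, ?_⟩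
  · rintro _ ⟨_, ⟨q, -, rfl⟩, rfl⟩
    refine ⟨(Polynomial.X * q) %ₘ h, ?_, ?_⟩
    · rw [SetLike.mem_coe, mem_degreeLT, ← degree_eq_natDegree hm.ne_zero]
      exact degree_modByMonic_lt _ hm
    · rw [hmod, he, he, map_mul, aeval_X, Module.End.mul_apply]
  · refine (Submodule.ne_bot_iff _).2 ⟨w, ⟨1, ?_, by simp [he]⟩, hw⟩
    rw [SetLike.mem_coe, mem_degreeLT, degree_one]
    exact_mod_cast Nat.pos_of_ne_zero hd
  · exact (Submodule.finrank_map_le _ _).trans hfin.le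

variable [IsPrincipalIdealRing R] [Module.Free R M] [Module.Finite R M]

/-- If `N` had smaller rank, the characteristic polynomial of the restriction would have smaller
degree, giving a Bézout relation with `φ.charpoly`. Both polynomials kill `v ∈ N`, so the nonzero
constant `b` kills `v ≠ 0`. -/
lemma finrank_eq_of_irreducible_charpoly {φ : Module.End R M} (hφ : Irreducible φ.charpoly)
    {N : Submodule R M} (hN : N.map φ ≤ N) (h0 : N ≠ ⊥) :
    Module.finrank R N = Module.finrank R M := by
  have hN' : ∀ x ∈ N, φ x ∈ N := fun x hx => hN ⟨x, hx, rfl⟩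
  refine le_antisymm (Submodule.finrank_le N) (not_lt.1 fun hlt => ?_)
  obtain ⟨v, hv, hv0⟩ := N.exists_mem_ne_zero_of_ne_bot h0
  obtain ⟨b, u, w, hb, h⟩ := exists_bezout_of_irreducible hφ φ.charpoly_monic
    (φ.restrict hN').charpoly_monic.ne_zero (by simpa [LinearMap.charpoly_natDegree] using hlt)
  have h1 : aeval φ (φ.restrict hN').charpoly v = 0 := by
    have := aeval_restrict_apply hN' (φ.restrict hN').charpoly ⟨v, hv⟩
    rw [← this, LinearMap.aeval_self_charpoly]
    rfl
  have h2 := congrArg (fun p => aeval φ p v) h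
  simp only [map_add, map_mul, LinearMap.add_apply, Module.End.mul_apply, h1,
    LinearMap.aeval_self_charpoly, aeval_C, Module.algebraMap_end_apply, LinearMap.zero_apply,
    map_zero, add_zero] at h2
  exact (smul_ne_zero hb hv0) h2.symm

/-- An endomorphism of a free module over a principal ideal domain has irreducible characteristic
polynomial if and only if its nonzero invariant submodules have full rank. -/
lemma irreducible_charpoly_iff (φ : Module.End R M) (hr : 0 < Module.finrank R M) :
    Irreducible φ.charpoly ↔ ∀ N : Submodule R M, N.map φ ≤ N → N ≠ ⊥ →
      Module.finrank R N = Module.finrank R M := by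
  refine ⟨fun h N hN h0 => finrank_eq_of_irreducible_charpoly h hN h0, fun H => ?_⟩
  rw [φ.charpoly_monic.irreducible_iff_natDegree]
  refine ⟨fun h => ?_, fun f g hf hg hfg => ?_⟩
  · rw [← φ.charpoly_natDegree, h, natDegree_one] at hr
    exact hr.false
  by_contra! hcon
  have hdeg : f.natDegree + g.natDegree = Module.finrank R M := by
    rw [← hf.natDegree_mul hg, hfg, φ.charpoly_natDegree]
  have : Nontrivial M := Module.nontrivial_of_finrank_pos hr
  obtain ⟨v, hv⟩ := exists_ne (0 : M)
  -- By Cayley–Hamilton `f(φ) g(φ) = 0`, so either `g` kills `v` or `f` kills the nonzero vector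
  -- `g(φ) v`. In both cases a cyclic submodule has rank between `1` and `r - 1`.
  by_cases hgv : aeval φ g v = 0
  · obtain ⟨N, hN, h0, hle⟩ := exists_invariant_of_aeval_eq_zero φ hg hcon.2 hv hgv
    have := H N hN h0
    omega
  · obtain ⟨N, hN, h0, hle⟩ := exists_invariant_of_aeval_eq_zero φ hf hcon.1 hgv (by
      rw [← Module.End.mul_apply, ← map_mul, hfg, LinearMap.aeval_self_charpoly]
      rfl)
    have := H N hN h0
    omega

end charpoly

lemma hasNoInvariantSubbundle_iff_irreducible {r : ℕ} (hr : 0 < r) {a : Fin r → ℤ} {n : ℤ}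
    (Φ : Hom a (twistType a n)) :
    HasNoInvariantSubbundle Φ ↔ Irreducible (LinearMap.toMatrix' (Hom.on0 Φ)).charpoly := by
  have h := irreducible_charpoly_iff (Hom.on0 Φ) (by simpa using hr)
  rw [Module.finrank_fin_fun] at h
  rw [hasNoInvariantSubbundle_iff, ← h,
    ← LinearMap.charpoly_toMatrix _ (Pi.basisFun ℂ[X] (Fin r)), LinearMap.toMatrix_eq_toMatrix']

/-! ### Sections of line bundles, degrees of subsheaves, stability -/

/-- The pair `f`, `g` is a section of `𝒪(e)`. In particular `e < 0` leaves only the zero section. -/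
lemma natDegree_le_of_fun0_eq {f g : ℂ[X]} {e : ℤ} (hf : f ≠ 0) (h : fun0 f = T e * fun1 g) :
    (f.natDegree : ℤ) ≤ e := by
  have hrev : fun0 g.reverse = fun1 g * T (g.natDegree : ℤ) := toLaurent_reverse g
  -- Writing `e = e.toNat - (-e).toNat` and replacing `g(z⁻¹)` by the reversed polynomial leaves
  -- only natural exponents.
  have key : X ^ (g.natDegree + (-e).toNat) * f = X ^ e.toNat * g.reverse := by
    apply fun0_injective
    rw [map_mul, map_mul, fun0_X_pow, fun0_X_pow, h, hrev]
    have : (e.toNat : ℤ) = e + (-e).toNat := by omega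
    rw [this]
    push_cast
    simp only [T_add]
    ring
  have hg : g.reverse ≠ 0 := by
    intro hg
    rw [hg, mul_zero] at key
    exact mul_ne_zero (pow_ne_zero _ Polynomial.X_ne_zero) hf key
  have h1 := congrArg natDegree key
  rw [natDegree_mul (pow_ne_zero _ Polynomial.X_ne_zero) hf,
    natDegree_mul (pow_ne_zero _ Polynomial.X_ne_zero) hg, natDegree_X_pow, natDegree_X_pow] at h1
  have h2 := reverse_natDegree_le g
  omega

lemma fun0_eq_symm {f g : ℂ[X]} {e : ℤ} (h : fun0 f = T e * fun1 g) :
    fun0 g = T e * fun1 f := by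
  have h1 := congrArg (invert (R := ℂ)) h
  have h2 : ∀ y : ℂ[T;T⁻¹], invert (invert y) = y := involutive_invert (R := ℂ)
  rw [map_mul, invert_T] at h1
  have h3 : invert (fun1 g) = fun0 g := h2 _
  have h4 : invert (fun0 f) = fun1 f := rfl
  rw [h3, h4] at h1
  rw [h1, ← mul_assoc, ← T_add]
  simp

section

variable {r : ℕ}

lemma res1_single (a : Fin r → ℤ) (j : Fin r) :
    res1 a (Pi.single j 1) = (T (a j) : ℂ[T;T⁻¹]) • res0 (Pi.single j 1) := by
  ext1 i
  by_cases h : i = j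
  · subst h; simp [res1, res0]
  · simp [res1, res0, h]

/-- Each matrix entry is a section of `ℋom(𝒪(a j), 𝒪(b i)) = 𝒪(b i - a j)`; this yields the degree
bounds and vanishing statements below. -/
lemma Hom.fun0_on0_single {s : ℕ} {a : Fin r → ℤ} {b : Fin s → ℤ} (Φ : Hom a b) (i : Fin s)
    (j : Fin r) : fun0 (Hom.on0 Φ (Pi.single j 1) i) =
      T (b i - a j) * fun1 (Hom.on1 Φ (Pi.single j 1) i) := by
  have h1 : res1 b (Hom.on1 Φ (Pi.single j 1)) =
      (T (a j) : ℂ[T;T⁻¹]) • res0 (Hom.on0 Φ (Pi.single j 1)) := by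
    rw [Hom.res1_on1, res1_single, map_smul, Hom.res0_on0]
  have h2 := congrFun h1 i
  simp only [res1, res0, Pi.smul_apply, smul_eq_mul] at h2
  rw [sub_eq_neg_add, T_add, mul_assoc, h2, ← mul_assoc, ← T_add]
  simp

lemma Hom.natDegree_on0_le {s : ℕ} {a : Fin r → ℤ} {b : Fin s → ℤ} (Φ : Hom a b) (i : Fin s)
    (j : Fin r) : (Hom.on0 Φ (Pi.single j 1) i).natDegree ≤ (b i - a j).toNat := by
  by_cases h : Hom.on0 Φ (Pi.single j 1) i = 0
  · simp [h]
  · have := natDegree_le_of_fun0_eq h (Hom.fun0_on0_single Φ i j)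
    omega

lemma Hom.on0_single_eq_zero {s : ℕ} {a : Fin r → ℤ} {b : Fin s → ℤ} (Φ : Hom a b) {i : Fin s}
    {j : Fin r} (h : b i < a j) : Hom.on0 Φ (Pi.single j 1) i = 0 := by
  by_contra h0
  have := natDegree_le_of_fun0_eq h0 (Hom.fun0_on0_single Φ i j)
  omega

lemma Hom.on1_single_eq_zero {s : ℕ} {a : Fin r → ℤ} {b : Fin s → ℤ} (Φ : Hom a b) {i : Fin s}
    {j : Fin r} (h : b i < a j) : Hom.on1 Φ (Pi.single j 1) i = 0 := by
  by_contra h0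
  have := natDegree_le_of_fun0_eq h0 (fun0_eq_symm (Hom.fun0_on0_single Φ i j))
  omega

lemma prod_T {ι : Type*} (s : Finset ι) (e : ι → ℤ) :
    ∏ i ∈ s, (T (e i) : ℂ[T;T⁻¹]) = T (∑ i ∈ s, e i) := by
  classical
  induction s using Finset.induction_on with
  | empty => simp
  | insert i s hi ih => rw [Finset.prod_insert hi, Finset.sum_insert hi, ih, T_add]

/-- The first `m` standard basis vectors. -/
noncomputable def stdVec {m : ℕ} (hm : m ≤ r) (j : Fin m) : Fin r → ℂ[X] :=
  Pi.single (Fin.castLE hm j) 1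

lemma linearIndependent_stdVec {m : ℕ} (hm : m ≤ r) : LinearIndependent ℂ[X] (stdVec hm) := by
  have h := (Pi.basisFun ℂ[X] (Fin r)).linearIndependent.comp _ (Fin.castLE_injective hm)
  convert h using 1
  ext1 j
  simp [stdVec]

lemma mem_span_stdVec {m : ℕ} {hm : m ≤ r} {v : Fin r → ℂ[X]} :
    v ∈ Submodule.span ℂ[X] (Set.range (stdVec hm)) ↔ ∀ i : Fin r, m ≤ i → v i = 0 := by
  constructor
  · intro hv i hi
    obtain ⟨c, rfl⟩ := (Submodule.mem_span_range_iff_exists_fun _).1 hv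
    rw [Finset.sum_apply]
    refine Finset.sum_eq_zero fun j _ => ?_
    have : i ≠ Fin.castLE hm j := by
      rintro rfl
      exact absurd hi (by simp)
    simp [stdVec, this]
  · intro hv
    have h : v = ∑ i, v i • (Pi.single i 1 : Fin r → ℂ[X]) := by
      rw [← pi_eq_sum_univ' v]
    rw [h]
    refine Submodule.sum_mem _ fun i _ => ?_
    by_cases hi : m ≤ i
    · rw [hv i hi, zero_smul]
      exact Submodule.zero_mem _
    · exact Submodule.smul_mem _ _ (Submodule.subset_span ⟨⟨i, by omega⟩, rfl⟩)

namespace Subsheaf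

/-- The subsheaf generated by the first `m` summands. -/
noncomputable def coord (a : Fin r → ℤ) {m : ℕ} (hm : m ≤ r) : Subsheaf a where
  sec0 := Submodule.span ℂ[X] (Set.range (stdVec hm))
  sec1 := Submodule.span ℂ[X] (Set.range (stdVec hm))
  glue := by
    have h0 := span_res0_basis (Module.Basis.span (linearIndependent_stdVec hm))
    have h1 := span_res1_basis (a := a) (Module.Basis.span (linearIndependent_stdVec hm))
    rw [← h0, ← h1]
    simp only [Module.Basis.span_apply]
    apply le_antisymm <;> rw [Submodule.span_le] <;> rintro _ ⟨j, rfl⟩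
    · have h : res0 (stdVec hm j) =
          (T (-a (Fin.castLE hm j)) : ℂ[T;T⁻¹]) • res1 a (stdVec hm j) := by
        rw [stdVec, res1_single, smul_smul, ← T_add]; simp
      simp only [h]
      exact Submodule.smul_mem _ _ (Submodule.subset_span ⟨j, rfl⟩)
    · simp only [stdVec, res1_single]
      exact Submodule.smul_mem _ _ (Submodule.subset_span ⟨j, rfl⟩)

variable (a : Fin r → ℤ) {m : ℕ} (hm : m ≤ r)

lemma rank_coord : (coord a hm).rank = m := by
  rw [rank]
  exact (Module.finrank_eq_card_basis (Module.Basis.span (linearIndependent_stdVec hm))).trans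
    (Fintype.card_fin m)

lemma degree_coord : (coord a hm).degree = ∑ j, a (Fin.castLE hm j) := by
  have h : ∀ j, (Module.Basis.span (linearIndependent_stdVec hm) j : Fin r → ℂ[X]) =
      stdVec hm j := fun j => by rw [Module.Basis.span_apply]
  refine (hasDegree_degree _).unique ⟨m, Module.Basis.span (linearIndependent_stdVec hm),
    Module.Basis.span (linearIndependent_stdVec hm),
    Matrix.diagonal fun j => T (a (Fin.castLE hm j)), 1, fun j => ?_, one_ne_zero, ?_⟩
  · rw [Finset.sum_eq_single j]
    · rw [Matrix.diagonal_apply_eq]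
      exact (congrArg (res1 a) (h j)).trans ((res1_single a _).trans
        (congrArg (fun v => (T (a (Fin.castLE hm j)) : ℂ[T;T⁻¹]) • res0 v) (h j).symm))
    · intro i _ hi
      rw [Matrix.diagonal_apply_ne _ hi, zero_smul]
    · simp
  · rw [Matrix.det_diagonal, prod_T, map_one, one_mul]

/-- Makes the degree and rank of the whole bundle a special case of those of `coord`. -/
lemma coord_self : coord a le_rfl = ⊤ := by
  have h : Submodule.span ℂ[X] (Set.range (stdVec (le_refl r))) = ⊤ := by
    rw [eq_top_iff]
    intro v _
    exact mem_span_stdVec.2 fun i hi => absurd i.2 (by omega)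
  exact Subsheaf.ext h h

lemma degree_top : (⊤ : Subsheaf a).degree = ∑ j, a j := by
  rw [← coord_self, degree_coord]
  rfl

lemma rank_top : (⊤ : Subsheaf a).rank = r := by
  rw [← coord_self, rank_coord]

lemma isInvariant_coord {n : ℤ} (Φ : Hom a (twistType a n))
    (h : ∀ i j : Fin r, m ≤ i → j < m → a i + n < a j) : (coord a hm).IsInvariant Φ := by
  constructor
  · refine (Submodule.map_span_le _ _ _).2 ?_
    rintro _ ⟨j, rfl⟩
    exact mem_span_stdVec.2 fun i hi => Hom.on0_single_eq_zero Φ (h i _ hi j.2)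
  · refine (Submodule.map_span_le _ _ _).2 ?_
    rintro _ ⟨j, rfl⟩
    exact mem_span_stdVec.2 fun i hi => Hom.on1_single_eq_zero Φ (h i _ hi j.2)

end Subsheaf

lemma eq_top_of_isUnit_det {N : Submodule ℂ[X] (Fin r → ℂ[X])}
    (b : Module.Basis (Fin r) ℂ[X] N)
    (h : IsUnit (Matrix.of fun i j => (b j : Fin r → ℂ[X]) i).det) : N = ⊤ := by
  rw [eq_top_iff]
  intro v _
  set B : Matrix (Fin r) (Fin r) ℂ[X] := Matrix.of fun i j => (b j : Fin r → ℂ[X]) i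
  have hv : v = ∑ k, (B⁻¹.mulVec v) k • (b k : Fin r → ℂ[X]) := by
    have h1 : B.mulVec (B⁻¹.mulVec v) = v := by
      rw [Matrix.mulVec_mulVec, Matrix.mul_nonsing_inv _ h, Matrix.one_mulVec]
    conv_lhs => rw [← h1]
    ext1 i
    simp [Matrix.mulVec, dotProduct, B, mul_comm]
  rw [hv]
  exact Submodule.sum_mem _ fun k _ => N.smul_mem _ (b k).2

lemma det_ne_zero_of_basis {N : Submodule ℂ[X] (Fin r → ℂ[X])}
    (b : Module.Basis (Fin r) ℂ[X] N) :
    (Matrix.of fun i j => (b j : Fin r → ℂ[X]) i).det ≠ 0 := by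
  intro h
  obtain ⟨c, hc, h⟩ := Matrix.exists_mulVec_eq_zero_iff.2 h
  refine hc (funext (Fintype.linearIndependent_iff.1 (Subsheaf.linearIndependent_coe b) c ?_))
  ext1 i
  have := congrFun h i
  simpa [Matrix.mulVec, dotProduct, mul_comm] using this

/-- A proper subsheaf of full rank has smaller degree. -/
lemma Subsheaf.degree_lt_of_rank_eq {a : Fin r → ℤ} {F : Subsheaf a} (hF : F.rank = r)
    (htop : F ≠ ⊤) : F.degree < ∑ i, a i := by
  obtain ⟨s, b0, b1, P, c, hP, hc, hd⟩ := F.hasDegree_degree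
  have hs : s = r := by
    rw [← hF, rank, Module.finrank_eq_card_basis b0, Fintype.card_fin]
  subst hs
  set B0 : Matrix (Fin s) (Fin s) ℂ[X] := Matrix.of fun i j => (b0 j : Fin s → ℂ[X]) i with hB0
  set B1 : Matrix (Fin s) (Fin s) ℂ[X] := Matrix.of fun i j => (b1 j : Fin s → ℂ[X]) i with hB1
  -- The transition matrices of `E` and `F`, compared through the inclusion `F ⊆ E`.
  have key : Matrix.diagonal (fun i => (T (a i) : ℂ[T;T⁻¹])) * B1.map fun1 =
      B0.map fun0 * P := by
    ext1 i j
    have := congrFun (hP j) i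
    simp only [res1, Finset.sum_apply, Pi.smul_apply, smul_eq_mul, res0] at this
    rw [Matrix.diagonal_mul, Matrix.mul_apply]
    simp only [Matrix.map_apply, hB0, hB1, Matrix.of_apply, this]
    exact Finset.sum_congr rfl fun k _ => mul_comm _ _
  have hdet := congrArg Matrix.det key
  rw [Matrix.det_mul, Matrix.det_mul, Matrix.det_diagonal, prod_T, hd, ← RingHom.mapMatrix_apply,
    ← RingHom.mapMatrix_apply, ← RingHom.map_det, ← RingHom.map_det] at hdet
  -- Up to the constant `c`, the determinants of the inclusion form a section of `𝒪(deg E - deg F)`.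
  have h0 : fun0 (Polynomial.C c * B0.det) = T (∑ i, a i - F.degree) * fun1 B1.det := by
    have hC : fun0 (Polynomial.C c) = LaurentPolynomial.C c := toLaurent_C c
    rw [map_mul, hC, sub_eq_neg_add, T_add, mul_assoc, hdet]
    have : T (-F.degree) * T F.degree = (1 : ℂ[T;T⁻¹]) := by rw [← T_add]; simp
    linear_combination (-(LaurentPolynomial.C c * fun0 B0.det)) * this
  have hC0 : Polynomial.C c ≠ 0 := Polynomial.C_ne_zero.2 hc
  have hdeg0 := natDegree_le_of_fun0_eq (mul_ne_zero hC0 (det_ne_zero_of_basis b0)) h0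
  have hdeg1 := natDegree_le_of_fun0_eq (det_ne_zero_of_basis b1) (fun0_eq_symm h0)
  rw [natDegree_C_mul hc] at hdeg0
  -- If `deg F ≥ deg E`, both determinants have degree zero, hence are units, and `F` is everything
  -- on both charts.
  by_contra hlt
  refine htop (Subsheaf.ext (eq_top_of_isUnit_det b0 ?_) (eq_top_of_isUnit_det b1 ?_))
  · refine (Polynomial.isUnit_iff_degree_eq_zero).2 ?_
    rw [degree_eq_natDegree (det_ne_zero_of_basis b0)]
    norm_cast
    omega
  · refine (Polynomial.isUnit_iff_degree_eq_zero).2 ?_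
    rw [degree_eq_natDegree (det_ne_zero_of_basis b1)]
    norm_cast
    omega

lemma HasNoInvariantSubbundle.isStable (hr : 0 < r) {a : Fin r → ℤ} {n : ℤ}
    {Φ : Hom a (twistType a n)} (h : HasNoInvariantSubbundle Φ) : IsStable Φ := by
  intro F hbot htop hinv
  have hF : F.rank = r := (hasNoInvariantSubbundle_iff Φ).1 h F.sec0 hinv.1 fun h0 =>
    hbot (Subsheaf.eq_bot_of_sec0_eq_bot h0)
  rw [Subsheaf.slope, Subsheaf.slope, hF, Subsheaf.rank_top, Subsheaf.degree_top]
  have : (0 : ℚ) < r := by exact_mod_cast hr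
  gcongr
  exact_mod_cast Subsheaf.degree_lt_of_rank_eq hF htop

/-- The first summands of an antitone sequence with a drop have larger average than the whole. -/
lemma mul_sum_lt_mul_sum {a : Fin r → ℤ} (ha : Antitone a) {i : ℕ} (hi : i + 1 < r)
    (hlt : a ⟨i + 1, hi⟩ < a ⟨i, Nat.lt_of_succ_lt hi⟩) :
    (i + 1 : ℤ) * ∑ j, a j < r * ∑ j : Fin (i + 1), a (Fin.castLE hi.le j) := by
  obtain ⟨k, rfl⟩ := Nat.exists_eq_add_of_lt hi
  rw [show ∑ j, a j = ∑ j : Fin (i + 1), a (Fin.castLE hi.le j) +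
      ∑ j : Fin (k + 1), a (Fin.natAdd (i + 1) j) from
    Fin.sum_univ_add (a := i + 1) (b := k + 1) a]
  have h1 : ∑ _j : Fin (i + 1), a ⟨i, Nat.lt_of_succ_lt hi⟩ ≤
      ∑ j : Fin (i + 1), a (Fin.castLE hi.le j) :=
    Finset.sum_le_sum fun j _ => ha (Fin.le_def.2 (by simp; omega))
  have h2 : ∑ j : Fin (k + 1), a (Fin.natAdd (i + 1) j) ≤
      ∑ _j : Fin (k + 1), a ⟨i + 1, hi⟩ :=
    Finset.sum_le_sum fun j _ => ha (Fin.le_def.2 (by simp))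
  simp only [Finset.sum_const, Finset.card_univ, Fintype.card_fin, nsmul_eq_mul] at h1 h2
  generalize ∑ j : Fin (i + 1), a (Fin.castLE hi.le j) = A at *
  generalize ∑ j : Fin (k + 1), a (Fin.natAdd (i + 1) j) = B at *
  generalize a ⟨i, _⟩ = x at *
  generalize a ⟨i + 1, hi⟩ = y at *
  push_cast at *
  have hi0 : (0 : ℤ) < i + 1 := by positivity
  have hk0 : (0 : ℤ) < k + 1 := by positivity
  -- With `r = (i + 1) + (k + 1)`, the claim is `(i + 1) B < (k + 1) A`, and `(i + 1) (k + 1) y < (i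
  -- + 1) (k + 1) x` separates the two sides.
  have h3 := mul_le_mul_of_nonneg_left h1 hk0.le
  have h4 := mul_le_mul_of_nonneg_left h2 hi0.le
  have h5 := mul_lt_mul_of_pos_left hlt (mul_pos hi0 hk0)
  linarith

/-- Otherwise the first `i + 1` summands are invariant, because the blocks into the remaining ones
have negative degree. As `n ≥ 0`, the failed gap is a strict drop, so their slope is too large. -/
lemma IsSemistable.gap_le {a : Fin r → ℤ} (ha : Antitone a) {n : ℤ} (hn : 0 ≤ n)
    {Φ : Hom a (twistType a n)} (h : IsSemistable Φ) (i : ℕ) (hi : i + 1 < r) :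
    a ⟨i, Nat.lt_of_succ_lt hi⟩ - n ≤ a ⟨i + 1, hi⟩ := by
  by_contra! hlt
  have hrank := Subsheaf.rank_coord a hi.le
  have hbot : Subsheaf.coord a hi.le ≠ ⊥ := by
    intro h0
    have : (Subsheaf.coord a hi.le).rank = 0 := by
      rw [h0]
      exact finrank_bot _ _
    omega
  have htop : Subsheaf.coord a hi.le ≠ ⊤ := by
    intro h0
    rw [h0, Subsheaf.rank_top] at hrank
    omega
  have hinv : (Subsheaf.coord a hi.le).IsInvariant Φ := by
    refine Subsheaf.isInvariant_coord a hi.le Φ fun k j hk hj => ?_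
    have h1 : a k ≤ a ⟨i + 1, hi⟩ := ha (Fin.le_def.2 hk)
    have h2 : a ⟨i, Nat.lt_of_succ_lt hi⟩ ≤ a j := ha (Fin.le_def.2 (by simp; omega))
    omega
  have hs := h _ hbot htop hinv
  rw [Subsheaf.slope, Subsheaf.slope, hrank, Subsheaf.rank_top, Subsheaf.degree_top,
    Subsheaf.degree_coord, div_le_div_iff₀ (by positivity) (by exact_mod_cast (by omega))] at hs
  have h3 := mul_sum_lt_mul_sum ha hi (by omega)
  have h4 : (∑ j : Fin (i + 1), a (Fin.castLE hi.le j)) * r ≤ (∑ j, a j) * (i + 1) := by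
    exact_mod_cast hs
  linarith

end

/-! ### The companion morphism and its characteristic polynomial -/

/-- The morphism given by compatible matrices over `U₀` and `U₁`. -/
noncomputable def Hom.ofMatrix {r s : ℕ} {a : Fin r → ℤ} {b : Fin s → ℤ}
    (M M' : Matrix (Fin s) (Fin r) ℂ[X])
    (h : ∀ i j, fun0 (M i j) * T (a j) = T (b i) * fun1 (M' i j)) : Hom a b :=
  ⟨(M.mulVecLin, M'.mulVecLin, (M.map fun0).mulVecLin), by
    refine ⟨fun v => ?_, fun v => ?_⟩
    · ext1 i
      simp [Matrix.mulVec, dotProduct, res0]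
    · ext1 i
      simp only [Matrix.mulVecLin_apply, Matrix.mulVec, dotProduct, res1, Matrix.map_apply, map_sum,
        map_mul, Finset.mul_sum]
      refine Finset.sum_congr rfl fun j _ => ?_
      rw [← mul_assoc, h, mul_assoc]⟩

lemma exists_hom_companion {r : ℕ} {a : Fin r → ℤ} (ha : Antitone a) {n : ℤ} (hn : 1 ≤ n)
    (hgap : ∀ (i : ℕ) (hi : i + 1 < r), a ⟨i, Nat.lt_of_succ_lt hi⟩ - n ≤ a ⟨i + 1, hi⟩) :
    ∃ Φ : Hom a (twistType a n), Hom.on0 Φ = (companion r).mulVecLin := by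
  -- Over `U₁` the entries `1` and `z`, as sections of `𝒪(e)`, become `w ^ e` and `w ^ (e - 1)`. The
  -- gap condition gives `e ≥ 0` for the former; monotonicity and `n ≥ 1` give `e ≥ 1` for the
  -- latter, so `toNat` loses nothing.
  refine ⟨Hom.ofMatrix (companion r) (Matrix.of fun i j =>
    if (i : ℕ) = j + 1 then X ^ (a i + n - a j).toNat else
      if (i : ℕ) = 0 ∧ (j : ℕ) + 1 = r then X ^ (a i + n - a j - 1).toNat else 0) ?_, rfl⟩
  intro i j
  simp only [companion, Matrix.of_apply, twistType]
  split_ifs with h1 h2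
  · have h := hgap j (by omega)
    have hi : (⟨j + 1, by omega⟩ : Fin r) = i := Fin.ext h1.symm
    rw [hi] at h
    simp only [Fin.eta] at h
    rw [fun1_X_pow, ← T_add, map_one, one_mul]
    congr 1
    omega
  · have h : a j ≤ a i := ha (Fin.le_def.2 (by omega))
    rw [fun1_X_pow, ← T_add, ← pow_one X, fun0_X_pow, ← T_add]
    congr 1
    push_cast
    omega
  · simp

/-- Eisenstein at the prime `z`: the constant term `-z` is not divisible by `z ^ 2`. -/
lemma irreducible_X_pow_sub_C_X {r : ℕ} (hr : 0 < r) :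
    Irreducible (X ^ r - Polynomial.C X : ℂ[X][X]) := by
  have hm : (X ^ r - Polynomial.C X : ℂ[X][X]).Monic := monic_X_pow_sub_C _ hr.ne'
  have hd : (X ^ r - Polynomial.C X : ℂ[X][X]).degree = r := degree_X_pow_sub_C hr _
  refine irreducible_of_eisenstein_criterion (P := Ideal.span {X})
    ((Ideal.span_singleton_prime Polynomial.X_ne_zero).2 prime_X) ?_ ?_ ?_ ?_ hm.isPrimitive
  · rw [hm.leadingCoeff, Ideal.mem_span_singleton]
    exact fun h => not_isUnit_X (isUnit_of_dvd_one h)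
  · intro k hk
    rw [hd] at hk
    have hk' : k < r := by exact_mod_cast hk
    rw [coeff_sub, coeff_X_pow, if_neg hk'.ne, zero_sub, coeff_C]
    split_ifs
    · exact neg_mem (Ideal.mem_span_singleton_self _)
    · simp
  · rw [hd]
    exact_mod_cast hr
  · rw [coeff_sub, coeff_X_pow, if_neg hr.ne, zero_sub, coeff_C_zero, neg_mem_iff,
      Ideal.span_singleton_pow, Ideal.mem_span_singleton]
    intro h
    have := natDegree_le_of_dvd h Polynomial.X_ne_zero
    simp at this

lemma companion_pow_mulVec {r : ℕ} (hr : 0 < r) (k : ℕ) (hk : k < r) :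
    ((companion r).mulVecLin ^ k) (Pi.single ⟨0, hr⟩ 1) = Pi.single ⟨k, hk⟩ 1 := by
  induction k with
  | zero => rfl
  | succ k ih =>
    rw [pow_succ', Module.End.mul_apply, ih (by omega)]
    ext1 i
    simp only [Matrix.mulVecLin_apply, Matrix.mulVec_single_one, Matrix.col_apply, companion,
      Matrix.of_apply, Pi.single_apply, Fin.ext_iff]
    split_ifs <;> first | rfl | omega

/-- No determinant is expanded: `t ^ r - z` and the characteristic polynomial both kill `e₁`, and so
does their difference, of degree less than `r`. Were it nonzero, a Bézout relation with the
irreducible `t ^ r - z` would give a nonzero constant killing `e₁`. -/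
lemma charpoly_companion {r : ℕ} (hr : 0 < r) :
    (companion r).charpoly = X ^ r - Polynomial.C X := by
  set φ : Module.End ℂ[X] (Fin r → ℂ[X]) := (companion r).mulVecLin with hφ
  set e : Fin r → ℂ[X] := Pi.single ⟨0, hr⟩ 1 with he
  have he0 : e ≠ 0 := by simp [he]
  have hm : (X ^ r - Polynomial.C X : ℂ[X][X]).Monic := monic_X_pow_sub_C _ hr.ne'
  have hd : (X ^ r - Polynomial.C X : ℂ[X][X]).natDegree = r := natDegree_X_pow_sub_C
  have hc : (companion r).charpoly = φ.charpoly := by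
    rw [← LinearMap.charpoly_toMatrix φ (Pi.basisFun ℂ[X] (Fin r)),
      LinearMap.toMatrix_eq_toMatrix', hφ, ← Matrix.toLin'_apply', LinearMap.toMatrix'_toLin']
  have h1 : aeval φ (X ^ r - Polynomial.C X : ℂ[X][X]) e = 0 := by
    obtain ⟨k, rfl⟩ := Nat.exists_eq_succ_of_ne_zero hr.ne'
    have h := companion_pow_mulVec hr k (Nat.lt_succ_self k)
    rw [map_sub, map_pow, aeval_X, aeval_C, LinearMap.sub_apply, pow_succ', Module.End.mul_apply, h,
      Module.algebraMap_end_apply, sub_eq_zero]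
    ext1 i
    simp only [hφ, he, Matrix.mulVecLin_apply, Matrix.mulVec_single_one, Matrix.col_apply,
      companion, Matrix.of_apply, Pi.smul_apply, Pi.single_apply, Fin.ext_iff]
    have := i.2
    split_ifs <;> first | omega | simp_all
  by_contra hne
  rw [hc] at hne
  have hp : φ.charpoly - (X ^ r - Polynomial.C X) ≠ 0 := sub_ne_zero.2 hne
  have hlt : (φ.charpoly - (X ^ r - Polynomial.C X)).natDegree <
      (X ^ r - Polynomial.C X : ℂ[X][X]).natDegree := by
    have hd' : φ.charpoly.natDegree = r := by simp [LinearMap.charpoly_natDegree]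
    refine natDegree_lt_natDegree hp ?_ |>.trans_eq (hd'.trans hd.symm)
    refine degree_sub_lt_left ?_ φ.charpoly_monic.ne_zero ?_
    · rw [degree_eq_natDegree φ.charpoly_monic.ne_zero, degree_eq_natDegree hm.ne_zero, hd, hd']
    · rw [φ.charpoly_monic.leadingCoeff, hm.leadingCoeff]
  obtain ⟨b, u, w, hb, h⟩ :=
    exists_bezout_of_irreducible (irreducible_X_pow_sub_C_X hr) hm hp hlt
  have h2 : aeval φ (φ.charpoly - (X ^ r - Polynomial.C X)) e = 0 := by
    rw [map_sub, LinearMap.sub_apply, LinearMap.aeval_self_charpoly, h1]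
    simp
  have h3 := congrArg (fun p => aeval φ p e) h
  simp only [map_add, map_mul, LinearMap.add_apply, Module.End.mul_apply, h1, h2, aeval_C,
    Module.algebraMap_end_apply, map_zero, add_zero] at h3
  exact smul_ne_zero hb he0 h3.symm

/-! ### Families of bivariate polynomials -/

section bivariate

lemma coeff_coeff_swap {R : Type*} [CommSemiring R] (p : R[X][X]) (i j : ℕ) :
    ((Bivariate.swap p).coeff i).coeff j = (p.coeff j).coeff i := by
  induction p using Polynomial.induction_on' with
  | add p q hp hq => simp [hp, hq]
  | monomial n f =>
    induction f using Polynomial.induction_on' with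
    | add p q hp hq => simp [hp, hq, map_add]
    | monomial m c =>
      rw [Bivariate.swap_monomial_monomial]
      simp only [coeff_monomial]
      split_ifs <;> simp_all [coeff_monomial]

/-- A factor of a bivariate polynomial has no larger degree in the inner variable. -/
lemma coeff_coeff_eq_zero_of_mul {R : Type*} [CommRing R] [IsDomain R] {f g p : R[X][X]}
    (hp : p ≠ 0) (hfg : f * g = p) {D : ℕ} (hD : ∀ k j, D < j → (p.coeff k).coeff j = 0)
    {k j : ℕ} (hj : D < j) : (f.coeff k).coeff j = 0 := by
  have hp' : Bivariate.swap p ≠ 0 := (map_ne_zero_iff _ Bivariate.swap.injective).2 hp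
  rw [← hfg, map_mul] at hp'
  have h1 : (Bivariate.swap f).natDegree ≤ (Bivariate.swap p).natDegree := by
    rw [← hfg, map_mul, natDegree_mul (left_ne_zero_of_mul hp') (right_ne_zero_of_mul hp')]
    exact Nat.le_add_right _ _
  have h2 : (Bivariate.swap p).natDegree ≤ D := by
    refine natDegree_le_iff_coeff_eq_zero.2 fun i hi => ?_
    ext1 k
    rw [coeff_coeff_swap, hD k i hi, coeff_zero]
  rw [← coeff_coeff_swap, coeff_eq_zero_of_natDegree_lt (p := Bivariate.swap f) (by omega),
    coeff_zero]

variable {Z : Type*}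

lemma coeff_coeff_map_eval (Q : (Z → ℂ)[X][X]) (z : Z) (k j : ℕ) :
    ((Q.map (mapRingHom (Pi.evalRingHom (fun _ : Z => ℂ) z))).coeff k).coeff j =
      (Q.coeff k).coeff j z := by
  simp [coeff_map]

lemma ext_of_map_eval {Q Q' : (Z → ℂ)[X][X]}
    (h : ∀ z, Q.map (mapRingHom (Pi.evalRingHom (fun _ : Z => ℂ) z)) =
      Q'.map (mapRingHom (Pi.evalRingHom (fun _ : Z => ℂ) z))) : Q = Q' := by
  ext k j z
  rw [← coeff_coeff_map_eval, h, coeff_coeff_map_eval]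

/-- A family of bivariate polynomials of bounded degrees is a polynomial with coefficients in the
ring of functions. -/
lemma exists_map_eval_eq (q : Z → ℂ[X][X]) {D E : ℕ} (hE : ∀ z, (q z).natDegree ≤ E)
    (hD : ∀ z k j, D < j → ((q z).coeff k).coeff j = 0) :
    ∃ Q : (Z → ℂ)[X][X], ∀ z, Q.map (mapRingHom (Pi.evalRingHom (fun _ : Z => ℂ) z)) = q z := by
  refine ⟨∑ k ∈ Finset.range (E + 1), monomial k (∑ j ∈ Finset.range (D + 1),
    monomial j fun z => ((q z).coeff k).coeff j), fun z => ?_⟩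
  ext k j
  rw [coeff_coeff_map_eval]
  simp only [finsetSum_coeff, coeff_monomial, Finset.sum_ite_eq', Finset.mem_range]
  split_ifs with h
  · simp only [finsetSum_coeff, coeff_monomial, Finset.sum_ite_eq', Finset.mem_range]
    split_ifs with h'
    · rfl
    · exact (hD z k j (by omega)).symm
  · rw [coeff_eq_zero_of_natDegree_lt (p := q z) (by have := hE z; omega)]
    rfl

/-- The degree is only bounded because `Z` may be empty, in which case the coefficient ring is
trivial. -/
lemma monic_of_map_eval {Q : (Z → ℂ)[X][X]} {s : ℕ}
    (h : ∀ z, (Q.map (mapRingHom (Pi.evalRingHom (fun _ : Z => ℂ) z))).Monic)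
    (hs : ∀ z, (Q.map (mapRingHom (Pi.evalRingHom (fun _ : Z => ℂ) z))).natDegree = s) :
    Q.Monic ∧ Q.natDegree ≤ s := by
  have hle : Q.natDegree ≤ s := by
    refine natDegree_le_iff_coeff_eq_zero.2 fun k hk => ?_
    ext j z
    rw [← coeff_coeff_map_eval, coeff_eq_zero_of_natDegree_lt (n := k) (by rw [hs]; exact hk)]
    rfl
  refine ⟨monic_of_natDegree_le_of_coeff_eq_one s hle ?_, hle⟩
  ext j z
  rw [← coeff_coeff_map_eval, ← hs z, (h z).coeff_natDegree, coeff_one, coeff_one]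
  split_ifs <;> rfl

lemma exists_map_map_eq {S B : Type*} [Semiring S] [Semiring B] (φ : S →+* B) (Q : B[X][X])
    (h : ∀ k j, (Q.coeff k).coeff j ∈ Set.range φ) :
    ∃ Q' : S[X][X], Q'.map (mapRingHom φ) = Q := by
  have h1 : Q ∈ lifts (mapRingHom φ) := (lifts_iff_coeff_lifts Q).2 fun k =>
    (lifts_iff_coeff_lifts (Q.coeff k)).2 fun j => h k j
  obtain ⟨Q', hQ'⟩ := h1
  exact ⟨Q', hQ'⟩

end bivariate

/-! ### Extending points along integral extensions -/

section integral

/-- A point of `R` with values in an algebraically closed field, vanishing on the kernel of an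
integral extension `R → S`, extends to `S`. -/
lemma exists_extend_of_isIntegral {R S k : Type*} [CommRing R] [CommRing S] [Algebra R S]
    [Algebra.IsIntegral R S] [Field k] [IsAlgClosed k] [Algebra k R] (ε : R →ₐ[k] k)
    (h : RingHom.ker (algebraMap R S) ≤ RingHom.ker ε) :
    ∃ θ : S →+* k, θ.comp (algebraMap R S) = (ε : R →+* k) := by
  have hprime : (RingHom.ker ε).IsPrime := RingHom.ker_isPrime ε
  -- By lying over there is a prime `Q` above `ker ε`. The domain `S ⧸ Q` is integral over the
  -- algebraically closed `k`, hence equal to it, and the quotient map is the extension.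
  obtain ⟨Q, -, hQ, hcomap⟩ := Ideal.exists_ideal_over_prime_of_isIntegral (S := S)
    (RingHom.ker ε) ⊥ h
  let ι : k →+* S ⧸ Q := (Ideal.Quotient.mk Q).comp ((algebraMap R S).comp (algebraMap k R))
  let _ : Algebra k (S ⧸ Q) := ι.toAlgebra
  have hι : ι.comp (ε : R →+* k) = (Ideal.Quotient.mk Q).comp (algebraMap R S) := by
    ext x
    refine Ideal.Quotient.eq.2 ?_
    have hx : algebraMap k R (ε x) - x ∈ RingHom.ker ε := by
      rw [RingHom.mem_ker, map_sub, AlgHom.commutes]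
      simp
    rw [← hcomap, Ideal.mem_comap, map_sub] at hx
    exact hx
  have hint : Algebra.IsIntegral k (S ⧸ Q) := by
    refine ⟨fun x => ?_⟩
    obtain ⟨y, rfl⟩ := Ideal.Quotient.mk_surjective x
    obtain ⟨p, hp, hy⟩ := Algebra.IsIntegral.isIntegral (R := R) y
    refine ⟨p.map (ε : R →+* k), hp.map _, ?_⟩
    change (p.map (ε : R →+* k)).eval₂ ι _ = 0
    rw [eval₂_map, hι, ← hom_eval₂, hy, map_zero]
  let e := RingEquiv.ofBijective (algebraMap k (S ⧸ Q))
    IsAlgClosed.algebraMap_bijective_of_isIntegral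
  refine ⟨(e.symm : S ⧸ Q →+* k).comp (Ideal.Quotient.mk Q), ?_⟩
  rw [RingHom.comp_assoc, ← hι]
  ext x
  exact e.symm_apply_apply (ε x)

end integral

/-! ### The reducible locus is Zariski closed -/

section locus

/-- Coefficients of a monic factor of a monic polynomial are integral: here over `R[X]`, in `B[X]`.
A polynomial integral over `R[X]` has in turn coefficients integral over `R`. -/
lemma isIntegral_coeff_coeff_of_dvd {R B : Type*} [CommRing R] [CommRing B] [Algebra R B]
    {χ : R[X][X]} {Q : B[X][X]} (hχ : χ.Monic) (hQ : Q.Monic)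
    (h : Q ∣ χ.map (mapRingHom (algebraMap R B))) (k j : ℕ) :
    IsIntegral R ((Q.coeff k).coeff j) :=
  let _ : Algebra R[X] B[X] := Polynomial.algebra R B
  (isIntegral_coeff_of_dvd χ Q hχ hQ h k).coeff j

variable {R V : Type*} [CommRing R] [Algebra ℂ R] (pt : V → R →ₐ[ℂ] ℂ)

/-- The specialization at a point of a bivariate polynomial. -/
noncomputable def specialize (χ : R[X][X]) (v : V) : ℂ[X][X] :=
  χ.map (mapRingHom (pt v : R →+* ℂ))

/-- The points at which the specialization of `χ` has a monic factor of degree `s`. -/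
def factorLocus (χ : R[X][X]) (s : ℕ) : Set V :=
  {v | ∃ f g : ℂ[X][X], f.Monic ∧ g.Monic ∧ f.natDegree = s ∧ f * g = specialize pt χ v}

/-- The functions vanishing on a set of points. -/
def vanishing (W : Set V) : Ideal R where
  carrier := {p | ∀ v ∈ W, pt v p = 0}
  add_mem' := fun hp hq v hv => by rw [map_add, hp v hv, hq v hv, add_zero]
  zero_mem' := fun v _ => map_zero _
  smul_mem' := fun c p hp v hv => by rw [smul_eq_mul, map_mul, hp v hv, mul_zero]

variable {pt}

/-- The locus of polynomials with a monic factor of given degree is Zariski closed. -/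
lemma mem_factorLocus {χ : R[X][X]} (hχ : χ.Monic) {s : ℕ} {v : V}
    (hv : vanishing pt (factorLocus pt χ s) ≤ RingHom.ker (pt v)) : v ∈ factorLocus pt χ s := by
  let Z := factorLocus pt χ s
  -- An arbitrary choice of factorizations, with no regularity in `z`, is assembled into one
  -- factorization `F * G` over the ring of all functions on `Z`; integrality replaces regularity.
  choose f g hf hg hs hfg using fun z : Z => z.2
  have hχ0 : ∀ w, (specialize pt χ w).Monic := fun w => hχ.map _
  let D := (Bivariate.swap χ).natDegree
  have hD : ∀ w k j, D < j → ((specialize pt χ w).coeff k).coeff j = 0 := by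
    intro w k j hj
    have h : (χ.coeff k).coeff j = 0 := by
      rw [← coeff_coeff_swap, coeff_eq_zero_of_natDegree_lt hj, coeff_zero]
    simp [specialize, coeff_map, h]
  have hgs : ∀ z, (g z).natDegree = χ.natDegree - s := by
    intro z
    have h := congrArg natDegree (hfg z)
    rw [(hf z).natDegree_mul (hg z), hs, specialize, hχ.natDegree_map] at h
    omega
  obtain ⟨F, hF⟩ := exists_map_eval_eq f (fun z => (hs z).le)
    fun z k j hj => coeff_coeff_eq_zero_of_mul (hχ0 z).ne_zero (hfg z) (hD z) hj
  obtain ⟨G, hG⟩ := exists_map_eval_eq g (fun z => (hgs z).le)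
    fun z k j hj => coeff_coeff_eq_zero_of_mul (hχ0 z).ne_zero ((mul_comm _ _).trans (hfg z))
      (hD z) hj
  have hFm := (monic_of_map_eval (Q := F) (s := s) (fun z => by rw [hF]; exact hf z)
    (fun z => by rw [hF]; exact hs z)).1
  have hGm := (monic_of_map_eval (Q := G) (fun z => by rw [hG]; exact hg z)
    (fun z => by rw [hG]; exact hgs z)).1
  let ρ : R →+* (Z → ℂ) := RingHom.pi fun z => (pt (z : V) : R →+* ℂ)
  let _ : Algebra R (Z → ℂ) := ρ.toAlgebra
  have hFG : F * G = χ.map (mapRingHom (algebraMap R (Z → ℂ))) := by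
    apply ext_of_map_eval
    intro z
    rw [Polynomial.map_mul, hF, hG, hfg, Polynomial.map_map, mapRingHom_comp]
    rfl
  let S := integralClosure R (Z → ℂ)
  have hrange : ∀ Q : (Z → ℂ)[X][X], Q.Monic → Q ∣ χ.map (mapRingHom (algebraMap R (Z → ℂ))) →
      ∃ Q' : S[X][X], Q'.map (mapRingHom (algebraMap S (Z → ℂ))) = Q := by
    intro Q hQ hdvd
    refine exists_map_map_eq _ _ fun k j => ?_
    exact ⟨⟨_, isIntegral_coeff_coeff_of_dvd hχ hQ hdvd k j⟩, rfl⟩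
  obtain ⟨F', hF'⟩ := hrange F hFm ⟨G, hFG.symm⟩
  obtain ⟨G', hG'⟩ := hrange G hGm ⟨F, by rw [mul_comm G]; exact hFG.symm⟩
  have hinj : Function.Injective (mapRingHom (algebraMap S (Z → ℂ))) :=
    Polynomial.map_injective _ Subtype.val_injective
  have hF'm : F'.Monic := monic_of_injective hinj (by rw [hF']; exact hFm)
  have hG'm : G'.Monic := monic_of_injective hinj (by rw [hG']; exact hGm)
  have hFG' : F' * G' = χ.map (mapRingHom (algebraMap R S)) := by
    apply Polynomial.map_injective _ hinj
    rw [Polynomial.map_mul, hF', hG', hFG, Polynomial.map_map, mapRingHom_comp]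
    rfl
  -- An element of `R` that becomes zero in `S` vanishes on all of `Z`, hence at `v`. So `pt v`
  -- extends to `S`, and the extension carries the factorization over `S` to one at `v`.
  obtain ⟨θ, hθ⟩ := exists_extend_of_isIntegral (S := S) (pt v) (by
    intro p hp
    refine hv fun w hw => ?_
    have h1 : (algebraMap R S p : Z → ℂ) ⟨w, hw⟩ = 0 := by
      rw [RingHom.mem_ker.1 hp]
      rfl
    exact h1)
  -- A point of `Z` is needed to read off that the factor has degree exactly `s`.
  have hne : Nonempty Z := by
    by_contra hemp
    have : (1 : R) ∈ RingHom.ker (pt v) := hv fun w hw => (hemp ⟨w, hw⟩).elim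
    rw [RingHom.mem_ker, map_one] at this
    exact one_ne_zero this
  obtain ⟨z⟩ := hne
  refine ⟨F'.map (mapRingHom θ), G'.map (mapRingHom θ), hF'm.map _, hG'm.map _, ?_, ?_⟩
  · rw [hF'm.natDegree_map, ← natDegree_map_eq_of_injective hinj, hF', ← hs z, ← hF z,
      hFm.natDegree_map]
  · rw [← Polynomial.map_mul, hFG', Polynomial.map_map, mapRingHom_comp, hθ]
    rfl

/-- Reducibility is a Zariski closed condition on monic polynomials over `ℂ[z]`. -/
lemma not_irreducible_iff_vanishing {χ : R[X][X]} (hχ : χ.Monic) (hd : 0 < χ.natDegree) (v : V) :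
    ¬ Irreducible (specialize pt χ v) ↔
      ∀ p ∈ vanishing pt {w | ¬ Irreducible (specialize pt χ w)}, pt v p = 0 := by
  have hχ0 : ∀ w, (specialize pt χ w).Monic := fun w => hχ.map _
  have hdeg : ∀ w, (specialize pt χ w).natDegree = χ.natDegree := fun w => hχ.natDegree_map _
  have key : ∀ w, ¬ Irreducible (specialize pt χ w) ↔
      ∃ s ∈ Finset.Ioo 0 χ.natDegree, w ∈ factorLocus pt χ s := by
    intro w
    have h1 : specialize pt χ w ≠ 1 := by
      intro h
      have := hdeg w
      rw [h, natDegree_one] at this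
      omega
    rw [(hχ0 w).irreducible_iff_natDegree]
    simp only [not_and, ne_eq, h1, not_false_eq_true, true_imp_iff, not_forall, not_or]
    constructor
    · rintro ⟨f, g, hf, hg, hfg, hf0, hg0⟩
      have h2 := congrArg natDegree hfg
      rw [hf.natDegree_mul hg, hdeg] at h2
      exact ⟨f.natDegree, Finset.mem_Ioo.2 ⟨by omega, by omega⟩, f, g, hf, hg, rfl, hfg⟩
    · rintro ⟨s, hs, f, g, hf, hg, rfl, hfg⟩
      have h2 := congrArg natDegree hfg
      rw [hf.natDegree_mul hg, hdeg] at h2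
      rw [Finset.mem_Ioo] at hs
      exact ⟨f, g, hf, hg, hfg, by omega, by omega⟩
  refine ⟨fun hv p hp => hp v hv, fun hv => ?_⟩
  have hprime : (RingHom.ker (pt v)).IsPrime := RingHom.ker_isPrime _
  -- The reducible locus is a finite union over the degrees of a proper factor. The kernel of `pt v`
  -- is prime, so containing the intersection of the ideals it contains one of them.
  have hle : ((Finset.Ioo 0 χ.natDegree).inf fun s => vanishing pt (factorLocus pt χ s)) ≤
      RingHom.ker (pt v) := by
    intro p hp
    refine hv p fun w hw => ?_
    obtain ⟨s, hs, hw⟩ := (key w).1 hw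
    exact (Finset.inf_le (f := fun s => vanishing pt (factorLocus pt χ s)) hs) hp w hw
  obtain ⟨s, hs, hle⟩ := hprime.inf_le'.1 hle
  exact (key v).2 ⟨s, hs, mem_factorLocus hχ hle⟩

end locus

/-! ### Zariski openness in the space of morphisms -/

section

variable {r : ℕ} {a : Fin r → ℤ} {n : ℤ}

/-- The coefficient of `z ^ d` in the matrix entry `(i, j)`, as a linear form. -/
noncomputable def coeffForm (a : Fin r → ℤ) (n : ℤ) (i j : Fin r) (d : ℕ) :
    Module.Dual ℂ (Hom a (twistType a n)) where
  toFun Φ := (Hom.on0 Φ (Pi.single j 1) i).coeff d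
  map_add' Φ Ψ := by simp [Hom.on0]
  map_smul' c Φ := by simp [Hom.on0]

/-- A matrix with prescribed coefficients of its entries, specializing to all morphisms. -/
lemma exists_matrix_map_eq {R : Type*} [CommRing R] [Algebra ℂ R]
    (pt : Hom a (twistType a n) → R →ₐ[ℂ] ℂ)
    (h : ∀ l : Module.Dual ℂ (Hom a (twistType a n)), ∃ p : R, ∀ Φ, pt Φ p = l Φ) :
    ∃ M : Matrix (Fin r) (Fin r) R[X], ∀ Φ,
      M.map (mapRingHom (pt Φ : R →+* ℂ)) = LinearMap.toMatrix' (Hom.on0 Φ) := by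
  choose c hc using h
  -- By `Hom.natDegree_on0_le` the degrees of the entries are bounded independently of `Φ`.
  refine ⟨Matrix.of fun i j => ∑ d ∈ Finset.range ((twistType a n i - a j).toNat + 1),
    monomial d (c (coeffForm a n i j d)), fun Φ => ?_⟩
  ext i j d
  rw [LinearMap.toMatrix'_apply, Matrix.map_apply, Matrix.of_apply,
    coe_mapRingHom, coeff_map, finsetSum_coeff]
  simp only [coeff_monomial, Finset.sum_ite_eq', Finset.mem_range]
  split_ifs with h
  · exact hc _ Φ
  · rw [map_zero, coeff_eq_zero_of_natDegree_lt]
    have := Hom.natDegree_on0_le Φ i j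
    omega

/-- Forming characteristic polynomials commutes with specialization, so the condition on `Φ` is
irreducibility of a specialization of one universal monic polynomial. -/
lemma not_hasNoInvariantSubbundle_iff_vanishing (hr : 0 < r) {R : Type*} [CommRing R] [Algebra ℂ R]
    (pt : Hom a (twistType a n) → R →ₐ[ℂ] ℂ)
    (h : ∀ l : Module.Dual ℂ (Hom a (twistType a n)), ∃ p : R, ∀ Φ, pt Φ p = l Φ)
    (Φ : Hom a (twistType a n)) : ¬ HasNoInvariantSubbundle Φ ↔
      ∀ p ∈ vanishing pt {Ψ | ¬ HasNoInvariantSubbundle Ψ}, pt Φ p = 0 := by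
  obtain ⟨M, hM⟩ := exists_matrix_map_eq pt h
  have hs : ∀ Ψ, HasNoInvariantSubbundle Ψ ↔ Irreducible (specialize pt M.charpoly Ψ) := by
    intro Ψ
    rw [hasNoInvariantSubbundle_iff_irreducible hr, specialize, ← Matrix.charpoly_map, hM]
  simp only [hs]
  refine not_irreducible_iff_vanishing M.charpoly_monic ?_ Φ
  have : Nontrivial R := (pt Φ : R →+* ℂ).domain_nontrivial
  rw [Matrix.charpoly_natDegree_eq_dim, Fintype.card_fin]
  exact hr

/-- Evaluation of polynomial functions at a point. -/
def evalAt {V : Type*} [AddCommGroup V] [Module ℂ V] (v : V) : polyFun V →ₐ[ℂ] ℂ :=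
  (Pi.evalAlgHom ℂ (fun _ : V => ℂ) v).comp (polyFun V).val

lemma isZariskiOpen_hasNoInvariantSubbundle (hr : 0 < r) :
    IsZariskiOpen {Φ : Hom a (twistType a n) | HasNoInvariantSubbundle Φ} := by
  refine ⟨Subtype.val '' (vanishing evalAt
    {Ψ : Hom a (twistType a n) | ¬ HasNoInvariantSubbundle Ψ} : Set (polyFun _)), ?_, ?_⟩
  · rintro _ ⟨p, -, rfl⟩
    exact p.2
  · ext Φ
    refine (not_hasNoInvariantSubbundle_iff_vanishing hr evalAt
      (fun l => ⟨⟨l, Algebra.subset_adjoin ⟨l, rfl⟩⟩, fun _ => rfl⟩) Φ).trans ?_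
    refine ⟨?_, fun h p hp => h p ⟨p, hp, rfl⟩⟩
    rintro h _ ⟨p, hp, rfl⟩
    exact h p hp

end

end P1

theorem proposition5p1 {r : ℕ} (hr : 2 ≤ r) (a : Fin r → ℤ) (ha : Antitone a)
    (ℓ : ℤ) (hℓ : -1 ≤ ℓ) :
    (∀ Φ : P1.Hom a (P1.twistType a (2 + ℓ)), P1.IsSemistable Φ →
      ∀ (i : ℕ) (hi : i + 1 < r), a ⟨i + 1, hi⟩ ≥ a ⟨i, by omega⟩ - ℓ - 2) ∧
    ((∀ (i : ℕ) (hi : i + 1 < r), a ⟨i + 1, hi⟩ ≥ a ⟨i, by omega⟩ - ℓ - 2) →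
      (∃ Φ : P1.Hom a (P1.twistType a (2 + ℓ)), P1.HasNoInvariantSubbundle Φ ∧ P1.IsStable Φ ∧
        P1.Hom.on0 Φ = (P1.companion r).mulVecLin ∧ Irreducible (P1.companion r).charpoly) ∧
      (∀ Φ : P1.Hom a (P1.twistType a (2 + ℓ)), P1.HasNoInvariantSubbundle Φ → P1.IsStable Φ) ∧
      {Φ : P1.Hom a (P1.twistType a (2 + ℓ)) | P1.HasNoInvariantSubbundle Φ}.Nonempty ∧
      P1.IsZariskiOpen {Φ : P1.Hom a (P1.twistType a (2 + ℓ)) | P1.HasNoInvariantSubbundle Φ}) := by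
  have hr0 : 0 < r := by omega
  refine ⟨fun Φ hΦ i hi => ?_, fun hgap => ?_⟩
  · have := hΦ.gap_le ha (by omega) i hi
    omega
  have hirr : Irreducible (P1.companion r).charpoly := by
    rw [P1.charpoly_companion hr0]
    exact P1.irreducible_X_pow_sub_C_X hr0
  -- Here `ℓ ≥ -1` enters as `2 + ℓ ≥ 1`, leaving room for the entry `z`.
  obtain ⟨Φ, hΦ⟩ := P1.exists_hom_companion ha (n := 2 + ℓ) (by omega) fun i hi => by
    have := hgap i hi
    omega
  have hno : P1.HasNoInvariantSubbundle Φ := by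
    rw [P1.hasNoInvariantSubbundle_iff_irreducible hr0, hΦ, ← Matrix.toLin'_apply',
      LinearMap.toMatrix'_toLin']
    exact hirr
  exact ⟨⟨Φ, hno, hno.isStable hr0, hΦ, hirr⟩, fun Ψ hΨ => hΨ.isStable hr0, ⟨Φ, hno⟩,
    P1.isZariskiOpen_hasNoInvariantSubbundle hr0⟩
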